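/- Let $M$ be a compact smooth manifold of dimension $n \ge 1$, possibly with boundary, with cotangent bundle $\pi : T^*M \to M$. A \emph{star Hamiltonian} is a continuous proper function $H : T^*M \to [0,\infty)$ that is positive outside the zero section and satisfies $H(tp) = tH(p)$ for all $t > 0$ and $p \in T^*M$. A \emph{star body} is a set of the form $A = \{p \in T^*M : H(p) \le 1\}$ with $H$ a star Hamiltonian. Given a model star body $U = \{H_0 \le 1\}$ with boundary $\partial U = \{H_0 = 1\}$, the \emph{radial function} $\rho_A$ of $A$ is the restriction of $1/H$ to $\partial U$. For $\lambda > 0$ the dilation $\lambda A$ is the star body with radial function $\lambda \rho_A$, and the \emph{radial sum} $A \mathbin{\tilde\oplus} B$ of two star bodies is the star body with radial function $\rho_A + \rho_B$; neither depends on the choice of $U$. Let $\alpha$ be the canonical $1$-form on $T^*M$, $\alpha_p(v) = p(\pi_* v)$, let $\omega = d\alpha$, and let $V(A)$ denote the volume of $A$ with respect to the volume form $\omega^n/n!$. Theorem (Dual Brunn--Minkowski inequality). If $A$ and $B$ are star bodies in $T^*M$, then $V(A)$, $V(B)$ and $V(A \mathbin{\tilde\oplus} B)$ are finite and $$V(A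 \mathbin{\tilde\oplus} B)^{1/n} \le V(A)^{1/n} + V(B)^{1/n}.$$ If $n \ge 2$, equality holds if and only if $A$ and $B$ are dilations of each other, that is, $B = \lambda A$ for some $\lambda > 0$. -/

import Mathlib

open Bundle Set MeasureTheory Topology
open scoped Manifold ContDiff ENNReal

section CotangentBundleDefs

/-- The cotangent bundle `T*M` of a manifold `M` of dimension `n`, that is the bundle
`Hom(TM, ℝ)`, with Mathlib's topology and manifold structure. -/
abbrev CotangentBundle {n : ℕ} {H : Type*} [TopologicalSpace H]
    (I : ModelWithCorners ℝ (EuclideanSpace ℝ (Fin n)) H)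
    (M : Type*) [TopologicalSpace M] [ChartedSpace H M] : Type _ :=
  TotalSpace (EuclideanSpace ℝ (Fin n) →L[ℝ] ℝ) (fun x : M => TangentSpace I x →L[ℝ] ℝ)

/-- The model vector space of `T*M`. -/
abbrev CotangentModel (n : ℕ) : Type :=
  EuclideanSpace ℝ (Fin n) × (EuclideanSpace ℝ (Fin n) →L[ℝ] ℝ)

variable {n : ℕ} {H : Type*} [TopologicalSpace H]
  (I : ModelWithCorners ℝ (EuclideanSpace ℝ (Fin n)) H)
  (M : Type*) [TopologicalSpace M] [ChartedSpace H M]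

/-- Fibrewise multiplication of covectors by a real number. -/
noncomputable def CotangentBundle.scale {I : ModelWithCorners ℝ (EuclideanSpace ℝ (Fin n)) H} {M : Type*}
    [TopologicalSpace M] [ChartedSpace H M] (t : ℝ) (z : CotangentBundle I M) :
    CotangentBundle I M :=
  ⟨z.proj, t • z.snd⟩

variable [IsManifold I ∞ M]

/-! ### The Liouville volume -/

/-- The model with corners of the manifold `T*M`. -/
noncomputable abbrev CotangentBundle.model :
    ModelWithCorners ℝ (CotangentModel n) (ModelProd H (EuclideanSpace ℝ (Fin n) →L[ℝ] ℝ)) :=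
  I.prod 𝓘(ℝ, EuclideanSpace ℝ (Fin n) →L[ℝ] ℝ)

/-- The canonical 1-form `α` on `T*M`: `α_p(v) = p(π_* v)`. -/
noncomputable def canonicalOneForm (z : CotangentBundle I M) :
    TangentSpace (CotangentBundle.model I) z →L[ℝ] ℝ :=
  ContinuousLinearMap.comp (z.snd : TangentSpace I z.proj →L[ℝ] ℝ)
    (mfderiv (CotangentBundle.model I) I
      (TotalSpace.proj : CotangentBundle I M → M) z)

/-- The canonical 1-form written in the chart of `T*M` around `z₀` (its pullback by the inverse
of the chart). -/
noncomputable def canonicalOneFormInChart (z₀ : CotangentBundle I M) (y : CotangentModel n) :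
    CotangentModel n →L[ℝ] ℝ :=
  ContinuousLinearMap.comp
    (canonicalOneForm I M ((extChartAt (CotangentBundle.model I) z₀).symm y))
    (mfderivWithin 𝓘(ℝ, CotangentModel n) (CotangentBundle.model I)
      (extChartAt (CotangentBundle.model I) z₀).symm (range (CotangentBundle.model I)) y)

/-- The symplectic form `ω = dα` written in the chart of `T*M` around `z₀`. -/
noncomputable def symplecticFormInChart (z₀ : CotangentBundle I M) (y : CotangentModel n) :
    CotangentModel n [⋀^Fin 2]→L[ℝ] ℝ :=
  extDerivWithin
    (fun y' => ContinuousAlternatingMap.ofSubsingleton ℝ (CotangentModel n) ℝ (0 : Fin 1)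
      (canonicalOneFormInChart I M z₀ y'))
    (range (CotangentBundle.model I)) y

/-- The value `(η ∧ ⋯ ∧ η / n!)(u₁, w₁, …, uₙ, wₙ)` of the `n`-fold wedge power of a 2-form `η`,
where `uᵢ = v (inl i)` and `wᵢ = v (inr i)`; with the usual normalization of the wedge product,
`η^n(v₁, …, v₂ₙ) = 2⁻ⁿ ∑_σ sign(σ) ∏ᵢ η(v_{σ(2i-1)}, v_{σ(2i)})`. -/
noncomputable def wedgePowerDivFactorial {V : Type*} [NormedAddCommGroup V] [NormedSpace ℝ V]
    (n : ℕ) (η : V [⋀^Fin 2]→L[ℝ] ℝ) (v : Fin n ⊕ Fin n → V) : ℝ :=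
  ((n.factorial : ℝ) * 2 ^ n)⁻¹ *
    ∑ σ : Equiv.Perm (Fin n ⊕ Fin n), ((Equiv.Perm.sign σ : ℤ) : ℝ) *
      ∏ i : Fin n, η ![v (σ (Sum.inl i)), v (σ (Sum.inr i))]

/-- The standard basis of the model space of `T*M`: the standard basis of `ℝⁿ` together with its
dual basis. -/
noncomputable def cotangentModelBasis (n : ℕ) :
    Module.Basis (Fin n ⊕ Fin n) ℝ (CotangentModel n) :=
  (EuclideanSpace.basisFun (Fin n) ℝ).toBasis.prod
    ((EuclideanSpace.basisFun (Fin n) ℝ).toBasis.dualBasis.map LinearMap.toContinuousLinearMap)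

/-- The measure defined by the volume form `ω^n / n!` on the target of the chart of `T*M` around
`z₀`: its density with respect to the Lebesgue measure normalized by a basis is the absolute
value of the form on that basis. -/
noncomputable def liouvilleMeasureInChart (z₀ : CotangentBundle I M) :
    Measure (CotangentModel n) :=
  ((cotangentModelBasis n).addHaar.restrict
      (extChartAt (CotangentBundle.model I) z₀).target).withDensity
    (fun y => ENNReal.ofReal
      |wedgePowerDivFactorial n (symplecticFormInChart I M z₀ y) (cotangentModelBasis n)|)

/-- The Liouville measure on `T*M`, the Borel measure of the volume form `ω^n / n!`. The measures
that the form defines on the domains of the charts agree on overlaps; the measure glued from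
them is their supremum, the least measure on `T*M` that dominates each of them. -/
noncomputable def liouvilleMeasure : @Measure (CotangentBundle I M) (borel _) :=
  letI : MeasurableSpace (CotangentBundle I M) := borel _
  ⨆ z₀ : CotangentBundle I M,
    (liouvilleMeasureInChart I M z₀).map (extChartAt (CotangentBundle.model I) z₀).symm

/-! ### Star bodies -/

/-- A star Hamiltonian on `T*M`: a continuous proper function `T*M → [0, ∞)`, positive outside the
zero section and positively homogeneous of degree one. -/
structure StarHamiltonian where
  toFun : CotangentBundle I M → ℝ
  continuous_toFun : Continuous toFun
  nonneg : ∀ z, 0 ≤ toFun z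
  pos : ∀ z : CotangentBundle I M, z.snd ≠ 0 → 0 < toFun z
  homogeneous : ∀ t : ℝ, 0 < t → ∀ z, toFun (CotangentBundle.scale t z) = t * toFun z
  proper : IsProperMap toFun

/-- A star body in `T*M`: a set of the form `{p | H p ≤ 1}` for a star Hamiltonian `H`. -/
structure StarBody where
  carrier : Set (CotangentBundle I M)
  exists_hamiltonian : ∃ h : StarHamiltonian I M, carrier = {z | h.toFun z ≤ 1}

variable {I M}

theorem StarHamiltonian.toFun_zero (h : StarHamiltonian I M) {z : CotangentBundle I M}
    (hz : z.snd = 0) : h.toFun z = 0 := by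
  have h2 := h.homogeneous 2 two_pos z
  have : CotangentBundle.scale 2 z = z := by
    obtain ⟨x, p⟩ := z
    have hp : p = 0 := hz
    rw [hp]
    exact congrArg (TotalSpace.mk x) (smul_zero (2 : ℝ))
  rw [this] at h2
  linarith

theorem StarHamiltonian.eq_zero_iff (h : StarHamiltonian I M) (z : CotangentBundle I M) :
    h.toFun z = 0 ↔ z.snd = 0 :=
  ⟨fun h0 => by_contra fun hz => (h.pos z hz).ne' h0, h.toFun_zero⟩

/-- A star body determines its Hamiltonian. -/
theorem StarHamiltonian.toFun_unique {h k : StarHamiltonian I M}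
    (e : {z | h.toFun z ≤ 1} = {z | k.toFun z ≤ 1}) : h.toFun = k.toFun := by
  have key : ∀ h k : StarHamiltonian I M, {z | h.toFun z ≤ 1} = {z | k.toFun z ≤ 1} →
      ∀ z, k.toFun z ≤ h.toFun z := by
    intro h k e z
    by_cases hz : z.snd = 0
    · rw [h.toFun_zero hz, k.toFun_zero hz]
    · have hp := h.pos z hz
      have h1 : CotangentBundle.scale (h.toFun z)⁻¹ z ∈ {z | h.toFun z ≤ 1} := by
        simp only [mem_ofPred_eq]
        rw [h.homogeneous _ (inv_pos.2 hp), inv_mul_cancel₀ hp.ne']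
      rw [e] at h1
      simp only [mem_ofPred_eq] at h1
      rw [k.homogeneous _ (inv_pos.2 hp), inv_mul_le_iff₀ hp] at h1
      linarith
  exact funext fun z => le_antisymm (key k h e.symm z) (key h k e z)

/-- The star Hamiltonian of a star body. -/
noncomputable def StarBody.hamiltonian (A : StarBody I M) : StarHamiltonian I M :=
  A.exists_hamiltonian.choose

theorem StarBody.carrier_eq (A : StarBody I M) : A.carrier = {z | A.hamiltonian.toFun z ≤ 1} :=
  A.exists_hamiltonian.choose_spec

/-- The boundary `∂U` of a star body. -/
def StarBody.boundary (U : StarBody I M) : Set (CotangentBundle I M) :=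
  {z | U.hamiltonian.toFun z = 1}

/-- The radial function of `A` with respect to the model body `U`: the restriction of `1 / H` to
`∂U`, where `H` is the Hamiltonian of `A`. -/
noncomputable def StarBody.radialFunction (U A : StarBody I M) : U.boundary → ℝ :=
  fun p => 1 / A.hamiltonian.toFun p.1

/-- The volume of a star body. -/
noncomputable def StarBody.volume (A : StarBody I M) : ℝ≥0∞ :=
  liouvilleMeasure I M A.carrier

/-- The Hamiltonian `H / λ`, where `λ > 0`. -/
noncomputable def StarHamiltonian.dilate (c : ℝ) (hc : 0 < c) (h : StarHamiltonian I M) :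
    StarHamiltonian I M where
  toFun z := c⁻¹ * h.toFun z
  continuous_toFun := continuous_const.mul h.continuous_toFun
  nonneg z := mul_nonneg (inv_pos.2 hc).le (h.nonneg z)
  pos z hz := mul_pos (inv_pos.2 hc) (h.pos z hz)
  homogeneous t ht z := by rw [h.homogeneous t ht z]; ring
  proper := ((Homeomorph.mulLeft₀ c⁻¹ (inv_pos.2 hc).ne').isProperMap).comp h.proper

theorem StarHamiltonian.continuous_harmonic (h k : StarHamiltonian I M) :
    Continuous fun z => ((h.toFun z)⁻¹ + (k.toFun z)⁻¹)⁻¹ := by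
  rw [continuous_iff_continuousAt]
  intro z
  by_cases hz : z.snd = 0
  · have h0 : h.toFun z = 0 := h.toFun_zero hz
    have k0 : k.toFun z = 0 := k.toFun_zero hz
    have ht : Filter.Tendsto h.toFun (𝓝 z) (𝓝 0) := h0 ▸ h.continuous_toFun.continuousAt
    have hv : ((h.toFun z)⁻¹ + (k.toFun z)⁻¹)⁻¹ = 0 := by simp [h0, k0]
    change Filter.Tendsto _ _ (𝓝 ((h.toFun z)⁻¹ + (k.toFun z)⁻¹)⁻¹)
    rw [hv]
    refine squeeze_zero (fun w => ?_) (fun w => ?_) ht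
    · exact inv_nonneg.2 (add_nonneg (inv_nonneg.2 (h.nonneg w)) (inv_nonneg.2 (k.nonneg w)))
    · by_cases hw : w.snd = 0
      · simp [h.toFun_zero hw, k.toFun_zero hw]
      · exact inv_le_of_inv_le₀ (h.pos w hw)
          (le_add_of_nonneg_right (inv_nonneg.2 (k.nonneg w)))
  · have hp := h.pos z hz
    have kp := k.pos z hz
    exact ((h.continuous_toFun.continuousAt.inv₀ hp.ne').add
      (k.continuous_toFun.continuousAt.inv₀ kp.ne')).inv₀
        (add_pos (inv_pos.2 hp) (inv_pos.2 kp)).ne'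

theorem StarHamiltonian.isProperMap_harmonic (h k : StarHamiltonian I M) :
    IsProperMap fun z => ((h.toFun z)⁻¹ + (k.toFun z)⁻¹)⁻¹ := by
  rw [isProperMap_iff_isCompact_preimage]
  refine ⟨h.continuous_harmonic k, fun K hK => ?_⟩
  obtain ⟨c, hc⟩ := hK.bddAbove
  have h1 : IsCompact (h.toFun ⁻¹' Icc 0 (2 * c)) := h.proper.isCompact_preimage isCompact_Icc
  have h2 : IsCompact (k.toFun ⁻¹' Icc 0 (2 * c)) := k.proper.isCompact_preimage isCompact_Icc
  refine (h1.union h2).of_isClosed_subset (hK.isClosed.preimage (h.continuous_harmonic k)) ?_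
  intro z hz
  have hzc : ((h.toFun z)⁻¹ + (k.toFun z)⁻¹)⁻¹ ≤ c := hc hz
  by_cases h0 : z.snd = 0
  · left
    have : 0 ≤ c := by simpa [h.toFun_zero h0, k.toFun_zero h0] using hzc
    simpa [h.toFun_zero h0] using this
  · have hp := h.pos z h0
    have kp := k.pos z h0
    have hs : h.toFun z * k.toFun z ≤ c * (h.toFun z + k.toFun z) := by
      have e : ((h.toFun z)⁻¹ + (k.toFun z)⁻¹)⁻¹
          = h.toFun z * k.toFun z / (h.toFun z + k.toFun z) := by
        field_simp
        ring
      rw [e, div_le_iff₀ (add_pos hp kp)] at hzc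
      exact hzc
    rcases le_total (h.toFun z) (k.toFun z) with hle | hle
    · left
      refine ⟨hp.le, ?_⟩
      by_contra hcon
      push Not at hcon
      nlinarith
    · right
      refine ⟨kp.le, ?_⟩
      by_contra hcon
      push Not at hcon
      nlinarith

/-- The Hamiltonian `(H₁⁻¹ + H₂⁻¹)⁻¹` (zero on the zero section). -/
noncomputable def StarHamiltonian.radialSum (h k : StarHamiltonian I M) :
    StarHamiltonian I M where
  toFun z := ((h.toFun z)⁻¹ + (k.toFun z)⁻¹)⁻¹
  continuous_toFun := h.continuous_harmonic k
  nonneg z :=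
    inv_nonneg.2 (add_nonneg (inv_nonneg.2 (h.nonneg z)) (inv_nonneg.2 (k.nonneg z)))
  pos z hz := inv_pos.2 (add_pos (inv_pos.2 (h.pos z hz)) (inv_pos.2 (k.pos z hz)))
  homogeneous t ht z := by
    rw [h.homogeneous t ht z, k.homogeneous t ht z, mul_inv, mul_inv, ← mul_add, mul_inv, inv_inv]
  proper := h.isProperMap_harmonic k

/-- The dilation `c A`, where `c > 0`: the star body with radial function `c ρ_A`. -/
noncomputable def StarBody.dilate (c : ℝ) (hc : 0 < c) (A : StarBody I M) : StarBody I M where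
  carrier := {z | (A.hamiltonian.dilate c hc).toFun z ≤ 1}
  exists_hamiltonian := ⟨_, rfl⟩

/-- The radial sum of `A` and `B`: the star body with radial function `ρ_A + ρ_B`. -/
noncomputable def StarBody.radialSum (A B : StarBody I M) : StarBody I M where
  carrier := {z | (A.hamiltonian.radialSum B.hamiltonian).toFun z ≤ 1}
  exists_hamiltonian := ⟨_, rfl⟩

theorem StarBody.radialFunction_dilate (c : ℝ) (hc : 0 < c) (U A : StarBody I M)
    (p : U.boundary) :
    U.radialFunction (A.dilate c hc) p = c * U.radialFunction A p := by
  have e : (A.dilate c hc).hamiltonian.toFun = (A.hamiltonian.dilate c hc).toFun :=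
    StarHamiltonian.toFun_unique (A.dilate c hc).carrier_eq.symm
  simp only [StarBody.radialFunction, e]
  simp [StarHamiltonian.dilate, mul_comm]

theorem StarBody.radialFunction_radialSum (U A B : StarBody I M) (p : U.boundary) :
    U.radialFunction (A.radialSum B) p = U.radialFunction A p + U.radialFunction B p := by
  have e : (A.radialSum B).hamiltonian.toFun
      = (A.hamiltonian.radialSum B.hamiltonian).toFun :=
    StarHamiltonian.toFun_unique (A.radialSum B).carrier_eq.symm
  simp only [StarBody.radialFunction, e]
  simp [StarHamiltonian.radialSum]

end CotangentBundleDefs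

/-!
The Liouville measure `μ` enters only through three properties: it is finite on compact sets, it
charges every nonempty open set, and fibrewise multiplication by `t > 0` multiplies it by `t ^ n`.

*Charts.* The charts of `T*M` are cotangent lifts of charts of `M`, so in coordinates `(q, P)` the
canonical form is `P dq` (`canonicalOneFormInChart_eq`), its differential is the standard symplectic
form, and the density of `ω ^ n / n!` is a constant (`liouvilleMeasureInChart_eq`). This constant is
nonzero because all nonzero terms of the permutation sum that expresses the wedge power have the
same sign (`symplectic_term_nonneg`). A change of coordinates maps `(q, P ∘ Dτ(q))` to `(τ(q), P)`,
and by Fubini the Jacobian of `τ` on the base cancels the determinant on the fibres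
(`prod_measure_le_of_cotangent_lift`). Hence the measures carried by two charts agree on the overlap
and the supremum of these measures, over all charts, is on each chart domain bounded by the measure
of that chart. This gives local finiteness, hence finite volume of star bodies, which are compact;
the scaling law and the positivity on open sets are inherited from the charts.

*Volumes.* Let `f` and `g` be the Hamiltonians of `A` and `B`. Writing `(f / g) ^ n` as the integral
of `n t ^ (n - 1)` over `0 < t ≤ f / g`, exchanging integrals and rescaling by `t` turns
`∫_A (f / g) ^ n dμ` into `∫ n log⁺ (1 / g) dμ`, which does not involve `f`. The choice `f = g`
shows that this number is `V(B)`, so `V(B) = ∫_A (f / g) ^ n dμ`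
(`measure_sublevel_eq_lintegral_ratio_pow`). For the radial sum the ratio is `1 + f / g`, and the
inequality becomes Minkowski's inequality in `L^n(A, μ)` for the functions `1` and `f / g`. It
follows from a pointwise convexity inequality (`pow_one_add_le`), strict for `n ≥ 2` unless `f / g`
has one particular value. In the case of equality `f / g` is therefore constant almost everywhere
on `A`, hence everywhere by continuity and homogeneity, which says that `B` is a dilation of `A`.
-/

/-! ### Volumes of sublevel sets of homogeneous functions -/

theorem ofReal_pow_eq_lintegral {n : ℕ} (hn : 1 ≤ n) {r : ℝ} (hr : 0 ≤ r) :
    ENNReal.ofReal r ^ n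
      = ∫⁻ t in Ioc 0 r, ENNReal.ofReal (n * t ^ (n - 1)) := by
  have hint : IntervalIntegrable (fun t : ℝ => n * t ^ (n - 1)) volume 0 r :=
    (by fun_prop : Continuous fun t : ℝ => n * t ^ (n - 1)).intervalIntegrable _ _
  rw [← ofReal_integral_eq_lintegral_ofReal
    ((intervalIntegrable_iff_integrableOn_Ioc_of_le hr).1 hint),
    ← intervalIntegral.integral_of_le hr,
    ← ENNReal.ofReal_pow hr]
  · congr 1
    rw [intervalIntegral.integral_const_mul, integral_pow, Nat.sub_add_cancel hn]
    have : (n : ℝ) ≠ 0 := by positivity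
    have h1 : ((n - 1 : ℕ) : ℝ) + 1 = n := by exact_mod_cast Nat.sub_add_cancel hn
    rw [h1, zero_pow (by omega)]
    field_simp
    ring
  · filter_upwards [ae_restrict_mem measurableSet_Ioc] with t ht
    have := ht.1.le
    positivity

/-- Scale invariance of `dt / t`. -/
theorem lintegral_Icc_div_eq (c : ℝ) {a b : ℝ} (ha : 0 < a) (hb : 0 < b) :
    ∫⁻ t in Icc a (a / b), ENNReal.ofReal (c / t) = ∫⁻ t in Icc b 1, ENNReal.ofReal (c / t) := by
  have hk : 0 < a / b := div_pos ha hb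
  have him : (fun t => a / b * t) '' Icc b 1 = Icc a (a / b) := by
    rw [image_mul_left_Icc' hk]
    · congr 1 <;> field_simp
  rw [← him, lintegral_image_eq_lintegral_abs_deriv_mul measurableSet_Icc
    (fun t _ => ((hasDerivAt_id' t).const_mul (a / b)).hasDerivWithinAt)
    ((mul_right_injective₀ hk.ne').injOn)]
  refine lintegral_congr fun t => ?_
  rw [mul_one, abs_of_pos hk, ← ENNReal.ofReal_mul hk.le]
  congr 1
  field_simp

section
variable {Z : Type*} [MeasurableSpace Z] {μ : Measure Z} [SFinite μ] {n : ℕ} {s : ℝ → Z → Z}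
  {f g : Z → ℝ}

/-- The right-hand side is the integral of `n log⁺ (1 / g)`; the point is that it does not depend on
`f`. -/
theorem lintegral_ratio_pow_eq_lintegral_log (hn : 1 ≤ n)
    (hs : ∀ t : ℝ, 0 < t → ∀ S : Set Z, MeasurableSet S →
      ENNReal.ofReal t ^ n * μ (s t ⁻¹' S) = μ S)
    (hf : Measurable f) (hg : Measurable g)
    (hfs : ∀ t : ℝ, 0 < t → ∀ z, f (s t z) = t * f z)
    (hgs : ∀ t : ℝ, 0 < t → ∀ z, g (s t z) = t * g z)
    (hf0 : ∀ᵐ z ∂μ, 0 < f z) (hg0 : ∀ᵐ z ∂μ, 0 < g z) :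
    ∫⁻ z in {z | f z ≤ 1}, ENNReal.ofReal (f z / g z) ^ n ∂μ
      = ∫⁻ z, (∫⁻ t in Icc (g z) 1, ENNReal.ofReal (n / t)) ∂μ := by
  have hm1 : MeasurableSet {p : Z × ℝ | f p.1 ≤ 1 ∧ p.2 ≤ f p.1 / g p.1} := by
    rw [ofPred_and]
    exact (measurableSet_le (by fun_prop) (by fun_prop)).inter
      (measurableSet_le (by fun_prop) (by fun_prop))
  have hm2 : MeasurableSet {p : Z × ℝ | f p.1 ≤ p.2 ∧ p.2 ≤ f p.1 / g p.1} := by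
    rw [ofPred_and]
    exact (measurableSet_le (by fun_prop) (by fun_prop)).inter
      (measurableSet_le (by fun_prop) (by fun_prop))
  calc ∫⁻ z in {z | f z ≤ 1}, ENNReal.ofReal (f z / g z) ^ n ∂μ
      = ∫⁻ z, (∫⁻ t in Ioi (0 : ℝ), {p : Z × ℝ | f p.1 ≤ 1 ∧ p.2 ≤ f p.1 / g p.1}.indicator
          (fun p : Z × ℝ => ENNReal.ofReal (n * p.2 ^ (n - 1))) (z, t)) ∂μ := by
        rw [← lintegral_indicator (measurableSet_le hf measurable_const)]
        refine lintegral_congr_ae ?_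
        filter_upwards [hf0, hg0] with z h1 h2
        by_cases hz : f z ≤ 1
        · rw [indicator_of_mem (by exact hz), ofReal_pow_eq_lintegral hn (by positivity)]
          rw [← Ioi_inter_Iic, inter_comm, ← Measure.restrict_restrict measurableSet_Iic,
            ← lintegral_indicator measurableSet_Iic]
          refine lintegral_congr fun t => ?_
          simp [indicator, hz]
        · rw [indicator_of_notMem (by exact hz)]
          simp [indicator, hz]
    _ = ∫⁻ t in Ioi (0 : ℝ), ∫⁻ z, {p : Z × ℝ | f p.1 ≤ 1 ∧ p.2 ≤ f p.1 / g p.1}.indicator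
          (fun p : Z × ℝ => ENNReal.ofReal (n * p.2 ^ (n - 1))) (z, t) ∂μ := by
        rw [lintegral_lintegral_swap]
        exact (Measurable.indicator (by fun_prop) hm1).aemeasurable
    _ = ∫⁻ t in Ioi (0 : ℝ), ∫⁻ z, {p : Z × ℝ | f p.1 ≤ p.2 ∧ p.2 ≤ f p.1 / g p.1}.indicator
          (fun p : Z × ℝ => ENNReal.ofReal (n / p.2)) (z, t) ∂μ := by
        -- rescaling by `t` maps `{f ≤ 1, t ≤ f / g}` onto `{f ≤ t ≤ f / g}`
        refine setLIntegral_congr_fun measurableSet_Ioi fun t (ht : 0 < t) => ?_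
        have e1 : ∀ z, {p : Z × ℝ | f p.1 ≤ 1 ∧ p.2 ≤ f p.1 / g p.1}.indicator
            (fun p => ENNReal.ofReal (n * p.2 ^ (n - 1))) (z, t)
            = {z | f z ≤ 1 ∧ t ≤ f z / g z}.indicator
              (fun _ => ENNReal.ofReal (n * t ^ (n - 1))) z := fun z => by simp [indicator]
        have e2 : ∀ z, {p : Z × ℝ | f p.1 ≤ p.2 ∧ p.2 ≤ f p.1 / g p.1}.indicator
            (fun p => ENNReal.ofReal (n / p.2)) (z, t)
            = {z | f z ≤ t ∧ t ≤ f z / g z}.indicator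
              (fun _ => ENNReal.ofReal (n / t)) z := fun z => by simp [indicator]
        have m1 : MeasurableSet {z | f z ≤ 1 ∧ t ≤ f z / g z} := by
          rw [ofPred_and]
          exact (measurableSet_le hf measurable_const).inter
            (measurableSet_le measurable_const (hf.div hg))
        have m2 : MeasurableSet {z | f z ≤ t ∧ t ≤ f z / g z} := by
          rw [ofPred_and]
          exact (measurableSet_le hf measurable_const).inter
            (measurableSet_le measurable_const (hf.div hg))
        have e3 : s t ⁻¹' {z | f z ≤ t ∧ t ≤ f z / g z} = {z | f z ≤ 1 ∧ t ≤ f z / g z} := by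
          ext z
          simp only [mem_preimage, mem_ofPred_eq, hfs t ht, hgs t ht]
          rw [mul_div_mul_left _ _ ht.ne', mul_le_iff_le_one_right ht]
        simp only [e1, e2]
        rw [lintegral_indicator_const m1, lintegral_indicator_const m2, ← hs t ht _ m2, e3,
          ← mul_assoc, ← ENNReal.ofReal_pow ht.le, ← ENNReal.ofReal_mul (by positivity)]
        congr 2
        obtain ⟨m, rfl⟩ : ∃ m, n = m + 1 := ⟨n - 1, by omega⟩
        rw [Nat.add_sub_cancel, pow_succ]
        field_simp
    _ = ∫⁻ z, (∫⁻ t in Ioi (0 : ℝ), {p : Z × ℝ | f p.1 ≤ p.2 ∧ p.2 ≤ f p.1 / g p.1}.indicator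
          (fun p : Z × ℝ => ENNReal.ofReal (n / p.2)) (z, t)) ∂μ := by
        rw [lintegral_lintegral_swap]
        exact (Measurable.indicator (f := fun p : Z × ℝ => ENNReal.ofReal (n / p.2))
          (by fun_prop) hm2).aemeasurable.prod_swap
    _ = _ := by
        refine lintegral_congr_ae ?_
        filter_upwards [hf0, hg0] with z h1 h2
        -- `dt / t` is invariant under multiplication by `f z / g z`
        rw [← lintegral_Icc_div_eq n h1 h2]
        have : Icc (f z) (f z / g z) = Icc (f z) (f z / g z) ∩ Ioi 0 :=
          (inter_eq_left.2 fun t ht => h1.trans_le ht.1).symm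
        rw [this, ← Measure.restrict_restrict measurableSet_Icc,
          ← lintegral_indicator measurableSet_Icc]
        refine lintegral_congr fun t => ?_
        simp [indicator]

/-- Integration in polar coordinates: the set `{g ≤ 1}` has radial function `f / g` relative to
`{f ≤ 1}`. -/
theorem measure_sublevel_eq_lintegral_ratio_pow (hn : 1 ≤ n)
    (hs : ∀ t : ℝ, 0 < t → ∀ S : Set Z, MeasurableSet S →
      ENNReal.ofReal t ^ n * μ (s t ⁻¹' S) = μ S)
    (hf : Measurable f) (hg : Measurable g)
    (hfs : ∀ t : ℝ, 0 < t → ∀ z, f (s t z) = t * f z)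
    (hgs : ∀ t : ℝ, 0 < t → ∀ z, g (s t z) = t * g z)
    (hf0 : ∀ᵐ z ∂μ, 0 < f z) (hg0 : ∀ᵐ z ∂μ, 0 < g z) :
    μ {z | g z ≤ 1} = ∫⁻ z in {z | f z ≤ 1}, ENNReal.ofReal (f z / g z) ^ n ∂μ := by
  rw [lintegral_ratio_pow_eq_lintegral_log hn hs hf hg hfs hgs hf0 hg0,
    ← lintegral_ratio_pow_eq_lintegral_log hn hs hg hg hgs hgs hg0 hg0, ← setLIntegral_one]
  refine lintegral_congr_ae (ae_restrict_of_ae ?_)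
  filter_upwards [hg0] with z hz
  rw [div_self hz.ne', ENNReal.ofReal_one, one_pow]

end

/-! ### Minkowski's inequality for a function and the constant one -/

/-- The supporting inequality for Minkowski: convexity of `x ^ n` at the points `(a + b) / a` and
`(a + b) / b * r`, with weights `a / (a + b)` and `b / (a + b)`. -/
theorem pow_one_add_le {n : ℕ} (hn : 1 ≤ n) {a b r : ℝ} (ha : 0 < a) (hb : 0 < b) (hr : 0 ≤ r) :
    (1 + r) ^ n ≤ ((a + b) / a) ^ (n - 1) + ((a + b) / b) ^ (n - 1) * r ^ n := by
  obtain ⟨m, rfl⟩ : ∃ m, n = m + 1 := ⟨n - 1, by omega⟩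
  have h := (convexOn_pow (𝕜 := ℝ) (m + 1)).2
    (mem_Ici.2 (show 0 ≤ (a + b) / a by positivity))
    (mem_Ici.2 (show 0 ≤ (a + b) / b * r by positivity))
    (show 0 ≤ a / (a + b) by positivity) (show 0 ≤ b / (a + b) by positivity) (by field_simp)
  simp only [smul_eq_mul] at h
  rw [Nat.add_sub_cancel]
  have e1 : a / (a + b) * ((a + b) / a) + b / (a + b) * ((a + b) / b * r) = 1 + r := by
    field_simp
  have e2 : a / (a + b) * ((a + b) / a) ^ (m + 1) + b / (a + b) * ((a + b) / b * r) ^ (m + 1)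
      = ((a + b) / a) ^ m + ((a + b) / b) ^ m * r ^ (m + 1) := by
    rw [mul_pow]; simp only [pow_succ]; field_simp
  rwa [e1, e2] at h

theorem eq_of_pow_one_add_eq {n : ℕ} (hn : 2 ≤ n) {a b r : ℝ} (ha : 0 < a) (hb : 0 < b)
    (hr : 0 ≤ r)
    (e : (1 + r) ^ n = ((a + b) / a) ^ (n - 1) + ((a + b) / b) ^ (n - 1) * r ^ n) :
    r = b / a := by
  by_contra hne
  obtain ⟨m, rfl⟩ : ∃ m, n = m + 1 := ⟨n - 1, by omega⟩
  have h := (strictConvexOn_pow hn).2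
    (mem_Ici.2 (show 0 ≤ (a + b) / a by positivity))
    (mem_Ici.2 (show 0 ≤ (a + b) / b * r by positivity))
    (by intro h; apply hne; field_simp at h ⊢; linarith)
    (show 0 < a / (a + b) by positivity) (show 0 < b / (a + b) by positivity) (by field_simp)
  simp only [smul_eq_mul] at h
  rw [Nat.add_sub_cancel] at e
  have e1 : a / (a + b) * ((a + b) / a) + b / (a + b) * ((a + b) / b * r) = 1 + r := by
    field_simp
  have e2 : a / (a + b) * ((a + b) / a) ^ (m + 1) + b / (a + b) * ((a + b) / b * r) ^ (m + 1)
      = ((a + b) / a) ^ m + ((a + b) / b) ^ m * r ^ (m + 1) := by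
    rw [mul_pow]; simp only [pow_succ]; field_simp
  rw [e1, e2] at h
  exact h.ne e

section
variable {Z : Type*} [MeasurableSpace Z] {μ : Measure Z} {n : ℕ} {r : Z → ℝ}

/-- If `1` and `r` have `L^n` norms `a` and `b`, the upper bound of `pow_one_add_le` integrates to
`(a + b) ^ n`. -/
theorem lintegral_convex_bound (hn : 1 ≤ n) (hr : Measurable r) {a b : ℝ} (ha : 0 < a)
    (hb : 0 < b) (hr0 : ∀ z, 0 ≤ r z)
    (hμ : μ univ = ENNReal.ofReal a ^ n)
    (hb' : ∫⁻ z, ENNReal.ofReal (r z) ^ n ∂μ = ENNReal.ofReal b ^ n) :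
    ∫⁻ z, ENNReal.ofReal (((a + b) / a) ^ (n - 1) + ((a + b) / b) ^ (n - 1) * r z ^ n) ∂μ
      = ENNReal.ofReal (a + b) ^ n := by
  have : ∀ z, ENNReal.ofReal (((a + b) / a) ^ (n - 1) + ((a + b) / b) ^ (n - 1) * r z ^ n)
      = ENNReal.ofReal (((a + b) / a) ^ (n - 1))
        + ENNReal.ofReal (((a + b) / b) ^ (n - 1)) * ENNReal.ofReal (r z) ^ n := fun z => by
    have := hr0 z
    rw [ENNReal.ofReal_add (by positivity) (by positivity), ENNReal.ofReal_mul (by positivity),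
      ENNReal.ofReal_pow this]
  simp only [this]
  rw [lintegral_add_left measurable_const, lintegral_const, lintegral_const_mul _ (by fun_prop),
    hμ, hb', ← ENNReal.ofReal_pow ha.le, ← ENNReal.ofReal_pow hb.le,
    ← ENNReal.ofReal_pow (by positivity), ← ENNReal.ofReal_mul (by positivity),
    ← ENNReal.ofReal_mul (by positivity), ← ENNReal.ofReal_add (by positivity) (by positivity)]
  congr 1
  obtain ⟨m, rfl⟩ : ∃ m, n = m + 1 := ⟨n - 1, by omega⟩
  rw [Nat.add_sub_cancel, div_pow, div_pow]
  simp only [pow_succ]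
  field_simp

theorem lintegral_one_add_pow_le (hn : 1 ≤ n) (hr : Measurable r) {a b : ℝ} (ha : 0 < a)
    (hb : 0 < b) (hr0 : ∀ z, 0 ≤ r z)
    (hμ : μ univ = ENNReal.ofReal a ^ n)
    (hb' : ∫⁻ z, ENNReal.ofReal (r z) ^ n ∂μ = ENNReal.ofReal b ^ n) :
    ∫⁻ z, ENNReal.ofReal (1 + r z) ^ n ∂μ ≤ ENNReal.ofReal (a + b) ^ n := by
  rw [← lintegral_convex_bound hn hr ha hb hr0 hμ hb']
  refine lintegral_mono fun z => ?_
  have := hr0 z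
  simp only
  rw [← ENNReal.ofReal_pow (by positivity)]
  exact ENNReal.ofReal_le_ofReal (pow_one_add_le hn ha hb (hr0 z))

theorem ae_eq_of_lintegral_one_add_pow_eq (hn : 2 ≤ n) (hr : Measurable r) {a b : ℝ} (ha : 0 < a)
    (hb : 0 < b) (hr0 : ∀ z, 0 ≤ r z)
    (hμ : μ univ = ENNReal.ofReal a ^ n)
    (hb' : ∫⁻ z, ENNReal.ofReal (r z) ^ n ∂μ = ENNReal.ofReal b ^ n)
    (e : ∫⁻ z, ENNReal.ofReal (1 + r z) ^ n ∂μ = ENNReal.ofReal (a + b) ^ n) :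
    ∀ᵐ z ∂μ, r z = b / a := by
  have hb2 := lintegral_convex_bound (one_le_two.trans hn) hr ha hb hr0 hμ hb'
  have h := ae_eq_of_ae_le_of_lintegral_le (μ := μ)
    (f := fun z => ENNReal.ofReal (1 + r z) ^ n)
    (g := fun z => ENNReal.ofReal
      (((a + b) / a) ^ (n - 1) + ((a + b) / b) ^ (n - 1) * r z ^ n))
    (Filter.Eventually.of_forall fun z => by
      have := hr0 z
      simp only
      rw [← ENNReal.ofReal_pow (by positivity)]
      exact ENNReal.ofReal_le_ofReal (pow_one_add_le (one_le_two.trans hn) ha hb (hr0 z)))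
    (by rw [e]; exact ENNReal.pow_ne_top ENNReal.ofReal_ne_top) (by fun_prop) (by rw [e, hb2])
  filter_upwards [h] with z hz
  have := hr0 z
  rw [← ENNReal.ofReal_pow (by positivity),
    ENNReal.ofReal_eq_ofReal_iff (by positivity) (by positivity)] at hz
  exact eq_of_pow_one_add_eq hn ha hb this hz
end

/-! ### The top power of the standard symplectic form -/

/-- The matrix of the standard symplectic form `(u, w) ↦ u.2 w.1 - w.2 u.1` in the standard basis of
the model space. -/
def symplecticEntry {n : ℕ} : Fin n ⊕ Fin n → Fin n ⊕ Fin n → ℝ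
  | .inl i, .inr j => if i = j then -1 else 0
  | .inr i, .inl j => if i = j then 1 else 0
  | _, _ => 0

theorem symplecticEntry_swap {n : ℕ} (a b : Fin n ⊕ Fin n) :
    symplecticEntry a b = - symplecticEntry b a := by
  rcases a with a | a <;> rcases b with b | b <;> simp [symplecticEntry, eq_comm (a := b)] <;>
    split_ifs <;> simp

/-- Every term of the permutation sum for `ω ^ n` on the standard basis has the sign `(-1) ^ n`, if
it does not vanish. Exchanging the two arguments of one factor changes the sign of the permutation
and of that factor, so it may be assumed that `σ` maps the first summand to itself; then the term is
nonzero only if `σ` acts in the same way on both summands, and such a `σ` is even. -/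
theorem symplectic_term_nonneg {n : ℕ} (σ : Equiv.Perm (Fin n ⊕ Fin n)) :
    0 ≤ (-1) ^ n * (((Equiv.Perm.sign σ : ℤ) : ℝ) *
      ∏ i : Fin n, symplecticEntry (σ (.inl i)) (σ (.inr i))) := by
  -- induction on the number of factors whose first argument lies in the second summand
  induction hk : {i : Fin n | (σ (.inl i)).isRight}.ncard using Nat.strong_induction_on
    generalizing σ with
  | _ k ih =>
  by_cases h : ∃ i, (σ (.inl i)).isRight
  · obtain ⟨i, hi⟩ := h
    by_cases hr : (σ (.inr i)).isRight
    · have : symplecticEntry (σ (.inl i)) (σ (.inr i)) = 0 := by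
        obtain ⟨a, ha⟩ := Sum.isRight_iff.1 hi
        obtain ⟨b, hb⟩ := Sum.isRight_iff.1 hr
        rw [ha, hb]; rfl
      rw [Finset.prod_eq_zero (Finset.mem_univ i) this]
      simp
    · have := ih _ ?_ (σ * Equiv.swap (Sum.inl i) (Sum.inr i)) rfl
      · convert this using 2
        rw [Equiv.Perm.sign_mul, Equiv.Perm.sign_swap (by simp)]
        have h1 : ∏ j : Fin n,
              symplecticEntry ((σ * Equiv.swap (Sum.inl i) (Sum.inr i)) (Sum.inl j))
              ((σ * Equiv.swap (Sum.inl i) (Sum.inr i)) (Sum.inr j))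
            = - ∏ j : Fin n, symplecticEntry (σ (Sum.inl j)) (σ (Sum.inr j)) := by
          rw [← Finset.mul_prod_erase _ _ (Finset.mem_univ i),
            ← Finset.mul_prod_erase _ _ (Finset.mem_univ i), ← neg_mul]
          congr 1
          · simp only [Equiv.Perm.mul_apply, Equiv.swap_apply_left, Equiv.swap_apply_right]
            exact symplecticEntry_swap _ _
          · refine Finset.prod_congr rfl fun j hj => ?_
            have := Finset.ne_of_mem_erase hj
            simp only [Equiv.Perm.mul_apply]
            rw [Equiv.swap_apply_of_ne_of_ne (Sum.inl_injective.ne this) Sum.inl_ne_inr,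
              Equiv.swap_apply_of_ne_of_ne Sum.inr_ne_inl (Sum.inr_injective.ne this)]
        rw [h1]
        push_cast
        ring
      · rw [← hk]
        refine Set.ncard_lt_ncard ⟨fun j hj => ?_, fun hcon => ?_⟩
        · simp only [Equiv.Perm.mul_apply, mem_ofPred_eq] at hj ⊢
          by_cases hji : j = i
          · rwa [hji]
          · rwa [Equiv.swap_apply_of_ne_of_ne (Sum.inl_injective.ne hji) Sum.inl_ne_inr] at hj
        · have := hcon hi
          simp only [Equiv.Perm.mul_apply, mem_ofPred_eq, Equiv.swap_apply_left] at this
          exact hr this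
  · push Not at h
    have hm : Set.MapsTo σ (Set.range Sum.inl) (Set.range Sum.inl) := by
      rintro _ ⟨i, rfl⟩
      have := h i
      rw [ne_eq, Bool.not_eq_true, Sum.isRight_eq_false] at this
      obtain ⟨a, ha⟩ := Sum.isLeft_iff.1 this
      exact ⟨a, ha.symm⟩
    obtain ⟨⟨p, q⟩, rfl⟩ := Equiv.Perm.mem_sumCongrHom_range_of_perm_mapsTo_inl hm
    simp only [Equiv.Perm.sumCongrHom_apply, Equiv.Perm.sign_sumCongr, Equiv.Perm.sumCongr_apply,
      Sum.map_inl, Sum.map_inr, symplecticEntry]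
    by_cases hpq : p = q
    · subst hpq
      simp only [if_true, Finset.prod_const, Finset.card_univ, Fintype.card_fin,
        Int.units_mul_self, Units.val_one, Int.cast_one, one_mul, ← mul_pow]
      norm_num
    · obtain ⟨i, hi⟩ : ∃ i, p i ≠ q i := by
        by_contra hcon
        push Not at hcon
        exact hpq (Equiv.ext hcon)
      rw [Finset.prod_eq_zero (Finset.mem_univ i) (by simp [hi])]
      simp

theorem symplectic_sum_ne_zero (n : ℕ) :
    ∑ σ : Equiv.Perm (Fin n ⊕ Fin n), ((Equiv.Perm.sign σ : ℤ) : ℝ) *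
      ∏ i : Fin n, symplecticEntry (σ (.inl i)) (σ (.inr i)) ≠ 0 := by
  have h : 0 < ∑ σ : Equiv.Perm (Fin n ⊕ Fin n), (-1) ^ n * (((Equiv.Perm.sign σ : ℤ) : ℝ) *
      ∏ i : Fin n, symplecticEntry (σ (.inl i)) (σ (.inr i))) := by
    refine Finset.sum_pos' (fun σ _ => symplectic_term_nonneg σ) ⟨1, Finset.mem_univ _, ?_⟩
    simp [symplecticEntry, ← mul_pow]
  rw [← Finset.mul_sum] at h
  exact right_ne_zero_of_mul h.ne'

/-- The absolute value of `ω ^ n / n!` on the standard basis of the model space, where `ω` is the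
canonical symplectic form. -/
noncomputable def liouvilleDensity (n : ℕ) : ℝ :=
  |((n.factorial : ℝ) * 2 ^ n)⁻¹ *
    ∑ σ : Equiv.Perm (Fin n ⊕ Fin n), ((Equiv.Perm.sign σ : ℤ) : ℝ) *
      ∏ i : Fin n, symplecticEntry (σ (.inl i)) (σ (.inr i))|

theorem liouvilleDensity_pos (n : ℕ) : 0 < liouvilleDensity n :=
  abs_pos.2 (mul_ne_zero (by positivity) (symplectic_sum_ne_zero n))

theorem abs_wedgePowerDivFactorial_eq {n : ℕ} {η : CotangentModel n [⋀^Fin 2]→L[ℝ] ℝ}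
    (hη : ∀ u w, η ![u, w] = u.2 w.1 - w.2 u.1) :
    |wedgePowerDivFactorial n η (cotangentModelBasis n)| = liouvilleDensity n := by
  have e : ∀ a b, η ![cotangentModelBasis n a, cotangentModelBasis n b] = symplecticEntry a b := by
    intro a b
    rw [hη]
    rcases a with a | a <;> rcases b with b | b <;>
      simp [cotangentModelBasis, symplecticEntry, eq_comm (a := b)]
    split_ifs <;> simp
  simp only [wedgePowerDivFactorial, e, liouvilleDensity]

/-! ### Cotangent lifts preserve volume -/

section
variable {E : Type*} [NormedAddCommGroup E] [NormedSpace ℝ E] [FiniteDimensional ℝ E]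

/-- Precomposition with `A` is the transpose of `A`, so it has the same determinant. -/
theorem det_precomp (A : E →L[ℝ] E) :
    LinearMap.det (((ContinuousLinearMap.compL ℝ E E ℝ).flip A : (E →L[ℝ] ℝ) →L[ℝ] (E →L[ℝ] ℝ)) :
      (E →L[ℝ] ℝ) →ₗ[ℝ] (E →L[ℝ] ℝ)) = LinearMap.det (A : E →ₗ[ℝ] E) := by
  rw [← LinearMap.det_dualMap (A : E →ₗ[ℝ] E),
    ← LinearMap.det_conj _ (LinearMap.toContinuousLinearMap : (E →ₗ[ℝ] ℝ) ≃ₗ[ℝ] (E →L[ℝ] ℝ))]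
  rfl

variable [MeasurableSpace E] [BorelSpace E] (μ : Measure E) [μ.IsAddHaarMeasure]
  (ν : Measure (E →L[ℝ] ℝ)) [ν.IsAddHaarMeasure]

/-- The cotangent lift `(q, P ∘ Dτ(q)) ↦ (τ(q), P)` of an injective differentiable map `τ` preserves
volume: the Jacobian of `τ` on the base cancels the determinant of `P ↦ P ∘ Dτ(q)` on the fibres. -/
theorem prod_measure_le_of_cotangent_lift {D : Set E} (hD : MeasurableSet D) {τ : E → E}
    {τ' : E → E →L[ℝ] E} (hτ : ∀ q ∈ D, HasFDerivWithinAt τ (τ' q) D q) (hinj : InjOn τ D)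
    (hdet : ∀ q ∈ D, LinearMap.det (τ' q : E →ₗ[ℝ] E) ≠ 0) {T T' : Set (E × (E →L[ℝ] ℝ))}
    (hT : MeasurableSet T) (hT' : MeasurableSet T') (hTD : ∀ y ∈ T, y.1 ∈ D)
    (h : ∀ q ∈ D, ∀ P : E →L[ℝ] ℝ, (q, P.comp (τ' q)) ∈ T → (τ q, P) ∈ T') :
    μ.prod ν T ≤ μ.prod ν T' := by
  have : ProperSpace E := FiniteDimensional.proper_real E
  have : ProperSpace (E →L[ℝ] ℝ) := FiniteDimensional.proper_real _
  rw [Measure.prod_apply hT, Measure.prod_apply hT']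
  calc ∫⁻ q, ν (Prod.mk q ⁻¹' T) ∂μ = ∫⁻ q in D, ν (Prod.mk q ⁻¹' T) ∂μ := by
        rw [← lintegral_indicator hD]
        refine lintegral_congr fun q => ?_
        by_cases hq : q ∈ D
        · rw [indicator_of_mem hq]
        · rw [indicator_of_notMem hq]
          convert measure_empty (μ := ν)
          exact eq_empty_of_forall_notMem fun P hP => hq (hTD _ hP)
    _ ≤ ∫⁻ q in D, ENNReal.ofReal |(τ' q).det| * ν (Prod.mk (τ q) ⁻¹' T') ∂μ := by
        refine setLIntegral_mono' hD fun q hq => ?_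
        have h1 := Measure.addHaar_preimage_linearMap ν
          (f := ((ContinuousLinearMap.compL ℝ E E ℝ).flip (τ' q) :
            (E →L[ℝ] ℝ) →L[ℝ] (E →L[ℝ] ℝ)))
          (by rw [det_precomp]; exact hdet q hq) (Prod.mk q ⁻¹' T)
        rw [det_precomp] at h1
        have h2 : ν (Prod.mk q ⁻¹' T) = ENNReal.ofReal |(τ' q).det| *
            (ENNReal.ofReal |(LinearMap.det (τ' q : E →ₗ[ℝ] E))⁻¹| * ν (Prod.mk q ⁻¹' T)) := by
          rw [← mul_assoc, ← ENNReal.ofReal_mul (abs_nonneg _), ← abs_mul]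
          change _ = ENNReal.ofReal |LinearMap.det (τ' q : E →ₗ[ℝ] E) * _| * _
          rw [mul_inv_cancel₀ (hdet q hq), abs_one, ENNReal.ofReal_one, one_mul]
        rw [h2, ← h1]
        gcongr
        exact fun P hP => h q hq P hP
    _ = ∫⁻ q in τ '' D, ν (Prod.mk q ⁻¹' T') ∂μ :=
        (lintegral_image_eq_lintegral_abs_det_fderiv_mul μ hD hτ hinj
          fun q => ν (Prod.mk q ⁻¹' T')).symm
    _ ≤ ∫⁻ q, ν (Prod.mk q ⁻¹' T') ∂μ := setLIntegral_le_lintegral _ _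
end

/-! ### Charts of the cotangent bundle -/

theorem measurableSet_extChartAt_target {n : ℕ} {H : Type*} [TopologicalSpace H]
    (I : ModelWithCorners ℝ (EuclideanSpace ℝ (Fin n)) H)
    (M : Type*) [TopologicalSpace M] [ChartedSpace H M] (x : M) :
    MeasurableSet (extChartAt I x).target := by
  rw [extChartAt_target]
  exact ((chartAt H x).open_target.preimage I.continuous_symm).measurableSet.inter
    I.isClosed_range.measurableSet

section
variable {n : ℕ} {H : Type*} [TopologicalSpace H]
  (I : ModelWithCorners ℝ (EuclideanSpace ℝ (Fin n)) H)
  (M : Type*) [TopologicalSpace M] [ChartedSpace H M] [IsManifold I ∞ M]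

theorem cotangent_extChartAt_source (z₀ : CotangentBundle I M) :
    (extChartAt (CotangentBundle.model I) z₀).source
      = TotalSpace.proj ⁻¹' (extChartAt I z₀.proj).source := by
  rw [FiberBundle.extChartAt, PartialEquiv.trans_source]
  ext z
  simp [hom_trivializationAt_apply]
 
theorem cotangent_extChartAt_target (z₀ : CotangentBundle I M) :
    (extChartAt (CotangentBundle.model I) z₀).target
      = (extChartAt I z₀.proj).target ×ˢ univ := by
  rw [FiberBundle.extChartAt_target]
  congr 1
  ext q
  simp +contextual

/-- The chart of `T*M` is the cotangent lift of the chart of `M`: a covector at `x` is pulled back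
by the inverse of the chart. -/
theorem cotangent_extChartAt_apply (z₀ : CotangentBundle I M) {z : CotangentBundle I M}
    (hz : z.proj ∈ (extChartAt I z₀.proj).source) :
    extChartAt (CotangentBundle.model I) z₀ z = (extChartAt I z₀.proj z.proj,
      ContinuousLinearMap.comp z.snd (mfderivWithin 𝓘(ℝ, EuclideanSpace ℝ (Fin n)) I
        (extChartAt I z₀.proj).symm (range I) (extChartAt I z₀.proj z.proj))) := by
  rw [FiberBundle.extChartAt, ← TangentBundle.symmL_trivializationAt (by simpa using hz)]
  refine Prod.ext rfl (ContinuousLinearMap.ext fun v => ?_)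
  change (trivializationAt ℝ (Bundle.Trivial M ℝ) z₀.proj).continuousLinearMapAt ℝ z.proj
    (z.snd ((trivializationAt (EuclideanSpace ℝ (Fin n)) (TangentSpace I) z₀.proj).symmL ℝ
      z.proj v)) = _
  exact congrArg (fun L : ℝ →L[ℝ] ℝ => L (z.snd
    ((trivializationAt (EuclideanSpace ℝ (Fin n)) (TangentSpace I) z₀.proj).symmL ℝ z.proj v)))
    (Bundle.Trivial.continuousLinearMapAt_trivialization ℝ M ℝ z.proj)

theorem cotangent_extChartAt_symm_proj (z₀ : CotangentBundle I M) {y : CotangentModel n}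
    (hy : y.1 ∈ (extChartAt I z₀.proj).target) :
    ((extChartAt (CotangentBundle.model I) z₀).symm y).proj = (extChartAt I z₀.proj).symm y.1 := by
  have hy' : y ∈ (extChartAt (CotangentBundle.model I) z₀).target := by
    rw [cotangent_extChartAt_target]; exact ⟨hy, mem_univ _⟩
  have h1 := (extChartAt (CotangentBundle.model I) z₀).map_target hy'
  rw [cotangent_extChartAt_source] at h1
  have h2 := (extChartAt (CotangentBundle.model I) z₀).right_inv hy'
  rw [cotangent_extChartAt_apply I M z₀ h1] at h2
  rw [← (extChartAt I z₀.proj).left_inv h1]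
  exact congrArg (fun w : CotangentModel n => (extChartAt I z₀.proj).symm w.1) h2

/-- The momentum coordinate of a covector, read off at the point given by the inverse chart. -/
theorem cotangent_extChartAt_symm_snd (z₀ : CotangentBundle I M) {y : CotangentModel n}
    (hy : y.1 ∈ (extChartAt I z₀.proj).target) :
    ContinuousLinearMap.comp ((extChartAt (CotangentBundle.model I) z₀).symm y).snd
      (mfderivWithin 𝓘(ℝ, EuclideanSpace ℝ (Fin n)) I
        (extChartAt I z₀.proj).symm (range I) y.1) = y.2 := by
  have hy' : y ∈ (extChartAt (CotangentBundle.model I) z₀).target := by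
    rw [cotangent_extChartAt_target]; exact ⟨hy, mem_univ _⟩
  have h1 := (extChartAt (CotangentBundle.model I) z₀).map_target hy'
  rw [cotangent_extChartAt_source] at h1
  have h2 := (extChartAt (CotangentBundle.model I) z₀).right_inv hy'
  rw [cotangent_extChartAt_apply I M z₀ h1] at h2
  have h3 := congrArg Prod.fst h2
  have h4 := congrArg Prod.snd h2
  simp only at h3 h4
  rw [h3] at h4
  exact h4

/-- In a chart the canonical form is `P dq`. -/
theorem canonicalOneFormInChart_eq (z₀ : CotangentBundle I M) {y : CotangentModel n}
    (hy : y.1 ∈ (extChartAt I z₀.proj).target) :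
    canonicalOneFormInChart I M z₀ y = y.2.comp (ContinuousLinearMap.fst ℝ _ _) := by
  have hy' : y ∈ (extChartAt (CotangentBundle.model I) z₀).target := by
    rw [cotangent_extChartAt_target]; exact ⟨hy, mem_univ _⟩
  have hyr := extChartAt_target_subset_range z₀ hy'
  have U : UniqueMDiffWithinAt 𝓘(ℝ, CotangentModel n) (range (CotangentBundle.model I)) y :=
    (CotangentBundle.model I).uniqueMDiffOn y hyr
  have hs : MDifferentiableWithinAt 𝓘(ℝ, CotangentModel n) (CotangentBundle.model I)
      (extChartAt (CotangentBundle.model I) z₀).symm (range (CotangentBundle.model I)) y :=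
    mdifferentiableWithinAt_extChartAt_symm hy'
  have hp : MDifferentiableAt (CotangentBundle.model I) I
      (TotalSpace.proj : CotangentBundle I M → M)
      ((extChartAt (CotangentBundle.model I) z₀).symm y) :=
    (contMDiff_proj (n := 1) (fun x : M => TangentSpace I x →L[ℝ] ℝ)).mdifferentiable
      one_ne_zero _
  have key : (mfderiv (CotangentBundle.model I) I (TotalSpace.proj : CotangentBundle I M → M)
      ((extChartAt (CotangentBundle.model I) z₀).symm y)).comp
      (mfderivWithin 𝓘(ℝ, CotangentModel n) (CotangentBundle.model I)
      (extChartAt (CotangentBundle.model I) z₀).symm (range (CotangentBundle.model I)) y)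
      = (mfderivWithin 𝓘(ℝ, EuclideanSpace ℝ (Fin n)) I
        (extChartAt I z₀.proj).symm (range I) y.1).comp
        (ContinuousLinearMap.fst ℝ (EuclideanSpace ℝ (Fin n))
          (EuclideanSpace ℝ (Fin n) →L[ℝ] ℝ)) := by
    rw [← mfderiv_comp_mfderivWithin _ hp hs U]
    have hf : HasMFDerivWithinAt 𝓘(ℝ, CotangentModel n) 𝓘(ℝ, EuclideanSpace ℝ (Fin n))
        (Prod.fst : CotangentModel n → _) (range (CotangentBundle.model I)) y
        (ContinuousLinearMap.fst ℝ (EuclideanSpace ℝ (Fin n)) (EuclideanSpace ℝ (Fin n) →L[ℝ] ℝ)) :=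
      (hasFDerivAt_fst.hasFDerivWithinAt).hasMFDerivWithinAt
    have he := (mdifferentiableWithinAt_extChartAt_symm hy).hasMFDerivWithinAt
    have hc := he.comp y hf (by
      rintro _ ⟨w, rfl⟩
      exact ⟨w.1, rfl⟩)
    refine HasMFDerivWithinAt.mfderivWithin (hc.congr_of_eventuallyEq ?_ ?_) U
    · filter_upwards [extChartAt_target_mem_nhdsWithin_of_mem hy'] with w hw
      rw [cotangent_extChartAt_target] at hw
      exact cotangent_extChartAt_symm_proj I M z₀ hw.1
    · exact cotangent_extChartAt_symm_proj I M z₀ hy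
  unfold canonicalOneFormInChart canonicalOneForm
  refine Eq.trans ?_ (congrArg (fun L : EuclideanSpace ℝ (Fin n) →L[ℝ] ℝ =>
    L.comp (ContinuousLinearMap.fst ℝ _ _)) (cotangent_extChartAt_symm_snd I M z₀ hy))
  exact congrArg (fun L => ContinuousLinearMap.comp
    ((extChartAt (CotangentBundle.model I) z₀).symm y).snd L) key

theorem symplecticFormInChart_apply (z₀ : CotangentBundle I M) {y : CotangentModel n}
    (hy : y.1 ∈ (extChartAt I z₀.proj).target) (u w : CotangentModel n) :
    symplecticFormInChart I M z₀ y ![u, w] = u.2 w.1 - w.2 u.1 := by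
  have hy' : y ∈ (extChartAt (CotangentBundle.model I) z₀).target := by
    rw [cotangent_extChartAt_target]; exact ⟨hy, mem_univ _⟩
  have hyr := extChartAt_target_subset_range z₀ hy'
  have U : UniqueDiffWithinAt ℝ (range (CotangentBundle.model I)) y :=
    (CotangentBundle.model I).uniqueDiffOn y hyr
  have hev : (fun y' => ContinuousAlternatingMap.ofSubsingleton ℝ (CotangentModel n) ℝ (0 : Fin 1)
      (canonicalOneFormInChart I M z₀ y')) =ᶠ[𝓝[range (CotangentBundle.model I)] y]
      fun y' => ContinuousAlternatingMap.ofSubsingleton ℝ (CotangentModel n) ℝ (0 : Fin 1)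
        (y'.2.comp (ContinuousLinearMap.fst ℝ _ _)) := by
    filter_upwards [extChartAt_target_mem_nhdsWithin_of_mem hy'] with w hw
    rw [cotangent_extChartAt_target] at hw
    rw [canonicalOneFormInChart_eq I M z₀ hw.1]
  -- the bilinear form `Λ y v = y.2 v.1`; in a chart the canonical form is `y ↦ Λ y`
  let Λ : CotangentModel n →L[ℝ] (CotangentModel n →L[ℝ] ℝ) :=
    ((ContinuousLinearMap.compL ℝ (CotangentModel n) (EuclideanSpace ℝ (Fin n)) ℝ).flip
      (ContinuousLinearMap.fst ℝ _ _)).comp (ContinuousLinearMap.snd ℝ _ _)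
  have hd : DifferentiableWithinAt ℝ
      (fun y' : CotangentModel n =>
        ContinuousAlternatingMap.ofSubsingleton ℝ (CotangentModel n) ℝ (0 : Fin 1)
        (y'.2.comp (ContinuousLinearMap.fst ℝ _ _))) (range (CotangentBundle.model I)) y :=
    ((ContinuousAlternatingMap.ofSubsingletonLIE (𝕜 := ℝ) (E := CotangentModel n) (F := ℝ)
      (0 : Fin 1)).toContinuousLinearEquiv.toContinuousLinearMap.comp
        Λ).differentiable.differentiableAt.differentiableWithinAt
  have hfd : ∀ v w : CotangentModel n, fderivWithin ℝ (fun y' : CotangentModel n => y'.2 v.1)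
      (range (CotangentBundle.model I)) y w = w.2 v.1 := by
    intro v w
    have : HasFDerivAt (fun y' : CotangentModel n => y'.2 v.1) (Λ.flip v) y :=
      (Λ.flip v).hasFDerivAt
    rw [this.hasFDerivWithinAt.fderivWithin U]
    rfl
  rw [symplecticFormInChart, hev.extDerivWithin_eq_of_mem hyr, extDerivWithin_apply hd U]
  have r0 : ∀ a b : CotangentModel n, (0 : Fin 2).removeNth ![a, b] = ![b] := fun a b => by
    funext i; fin_cases i; rfl
  have r1 : ∀ a b : CotangentModel n, (1 : Fin 2).removeNth ![a, b] = ![a] := fun a b => by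
    funext i; fin_cases i; rfl
  generalize range (CotangentBundle.model I) = R at hfd ⊢
  simp [Fin.sum_univ_two, r0, r1, hfd, sub_eq_add_neg]

/-- In every chart of the cotangent bundle `ω ^ n / n!` has the same constant density. -/
theorem liouvilleMeasureInChart_eq (z₀ : CotangentBundle I M) :
    liouvilleMeasureInChart I M z₀ = ENNReal.ofReal (liouvilleDensity n) •
      (cotangentModelBasis n).addHaar.restrict ((extChartAt I z₀.proj).target ×ˢ univ) := by
  rw [liouvilleMeasureInChart, cotangent_extChartAt_target, ← withDensity_const]
  refine withDensity_congr_ae ?_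
  filter_upwards [ae_restrict_mem
    ((measurableSet_extChartAt_target I M z₀.proj).prod MeasurableSet.univ)] with y hy
  rw [abs_wedgePowerDivFactorial_eq (symplecticFormInChart_apply I M z₀ hy.1)]

end

/-! ### The measures carried by the charts -/

theorem ContinuousOn.measurableSet_inter_preimage {X Y : Type*} [TopologicalSpace X]
    [MeasurableSpace X] [BorelSpace X] [TopologicalSpace Y] [MeasurableSpace Y] [BorelSpace Y]
    {f : X → Y} {s : Set X} (hf : ContinuousOn f s) (hs : MeasurableSet s) {t : Set Y}
    (ht : MeasurableSet t) : MeasurableSet (s ∩ f ⁻¹' t) := by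
  have := hs.subtype_image (hf.domRestrict.measurable ht)
  convert this using 1
  ext x
  simp [and_comm]

theorem cotangentModelBasis_addHaar_eq_prod (n : ℕ) :
    (cotangentModelBasis n).addHaar
      = (EuclideanSpace.basisFun (Fin n) ℝ).toBasis.addHaar.prod
        ((EuclideanSpace.basisFun (Fin n) ℝ).toBasis.dualBasis.map
          LinearMap.toContinuousLinearMap).addHaar :=
  Module.Basis.prod_addHaar _ _

theorem cotangentModelBasis_addHaar_preimage_fibre_smul {n : ℕ} {t : ℝ} (ht : 0 < t)
    {T : Set (CotangentModel n)} (hT : MeasurableSet T) :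
    ENNReal.ofReal t ^ n * (cotangentModelBasis n).addHaar
        ((fun y : CotangentModel n => (y.1, t • y.2)) ⁻¹' T)
      = (cotangentModelBasis n).addHaar T := by
  have hm : Measurable fun y : CotangentModel n => (y.1, t • y.2) :=
    (by fun_prop : Continuous fun y : CotangentModel n => (y.1, t • y.2)).measurable
  have hfr : Module.finrank ℝ (EuclideanSpace ℝ (Fin n) →L[ℝ] ℝ) = n := by
    rw [Module.finrank_eq_card_basis ((EuclideanSpace.basisFun (Fin n) ℝ).toBasis.dualBasis.map
          LinearMap.toContinuousLinearMap), Fintype.card_fin]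
  rw [cotangentModelBasis_addHaar_eq_prod, Measure.prod_apply (hm hT), Measure.prod_apply hT,
    ← lintegral_const_mul' _ _ (ENNReal.pow_ne_top ENNReal.ofReal_ne_top)]
  refine lintegral_congr fun q => ?_
  have h1 := Measure.addHaar_preimage_smul
    ((EuclideanSpace.basisFun (Fin n) ℝ).toBasis.dualBasis.map
          LinearMap.toContinuousLinearMap).addHaar ht.ne' (Prod.mk q ⁻¹' T)
  rw [hfr] at h1
  change ENNReal.ofReal t ^ n * Module.Basis.addHaar _ ((t • ·) ⁻¹' (Prod.mk q ⁻¹' T)) = _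
  rw [h1, ← mul_assoc, ← ENNReal.ofReal_pow ht.le, ← ENNReal.ofReal_mul (by positivity),
    abs_of_pos (by positivity), mul_inv_cancel₀ (by positivity), ENNReal.ofReal_one, one_mul]

section
variable {n : ℕ} {H : Type*} [TopologicalSpace H]
  (I : ModelWithCorners ℝ (EuclideanSpace ℝ (Fin n)) H)
  (M : Type*) [TopologicalSpace M] [ChartedSpace H M] [IsManifold I ∞ M]

/-- The Borel σ-algebra, with respect to which `liouvilleMeasure` is defined. -/
noncomputable instance CotangentBundle.instMeasurableSpace :
    MeasurableSpace (CotangentBundle I M) := borel _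

instance CotangentBundle.instBorelSpace : BorelSpace (CotangentBundle I M) := ⟨rfl⟩

/-- The measure on the cotangent bundle carried by the domain of one chart. -/
noncomputable def liouvilleChartMeasure (z₀ : CotangentBundle I M) :
    Measure (CotangentBundle I M) :=
  (liouvilleMeasureInChart I M z₀).map (extChartAt (CotangentBundle.model I) z₀).symm

theorem liouvilleMeasure_eq_iSup :
    liouvilleMeasure I M = ⨆ z₀ : CotangentBundle I M, liouvilleChartMeasure I M z₀ := rfl

theorem measurableSet_cotangent_target (z₀ : CotangentBundle I M) :
    MeasurableSet (extChartAt (CotangentBundle.model I) z₀).target := by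
  rw [cotangent_extChartAt_target]
  exact (measurableSet_extChartAt_target I M z₀.proj).prod MeasurableSet.univ

theorem liouvilleChartMeasure_apply (z₀ : CotangentBundle I M) {S : Set (CotangentBundle I M)}
    (hS : MeasurableSet S) :
    liouvilleChartMeasure I M z₀ S = ENNReal.ofReal (liouvilleDensity n) *
      (cotangentModelBasis n).addHaar ((extChartAt (CotangentBundle.model I) z₀).target ∩
        (extChartAt (CotangentBundle.model I) z₀).symm ⁻¹' S) := by
  have hm := measurableSet_cotangent_target I M z₀
  rw [liouvilleChartMeasure, liouvilleMeasureInChart_eq, ← cotangent_extChartAt_target,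
    Measure.map_apply_of_aemeasurable _ hS, Measure.smul_apply, Measure.restrict_apply' hm,
    inter_comm, smul_eq_mul]
  exact ((continuousOn_extChartAt_symm z₀).aemeasurable hm).smul_measure _

/-- On the domain of the chart at `z₁`, the measure of any other chart is at most that of the chart
at `z₁`, because the change of coordinates is a cotangent lift. -/
theorem liouvilleChartMeasure_le (z₀ z₁ : CotangentBundle I M) {S : Set (CotangentBundle I M)}
    (hS : MeasurableSet S) (hS₁ : S ⊆ (extChartAt (CotangentBundle.model I) z₁).source) :
    liouvilleChartMeasure I M z₀ S ≤ liouvilleChartMeasure I M z₁ S := by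
  rw [liouvilleChartMeasure_apply I M z₀ hS, liouvilleChartMeasure_apply I M z₁ hS]
  gcongr 1
  set e₀ := extChartAt I z₀.proj with he₀
  set e₁ := extChartAt I z₁.proj with he₁
  set D : Set (EuclideanSpace ℝ (Fin n)) := e₀.target ∩ e₀.symm ⁻¹' e₁.source with hDdef
  let τ' : EuclideanSpace ℝ (Fin n) → EuclideanSpace ℝ (Fin n) →L[ℝ] EuclideanSpace ℝ (Fin n) :=
    fun q => ContinuousLinearMap.comp
      (mfderiv I 𝓘(ℝ, EuclideanSpace ℝ (Fin n)) e₁ (e₀.symm q))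
      (mfderivWithin 𝓘(ℝ, EuclideanSpace ℝ (Fin n)) I e₀.symm (range I) q)
  have hD : MeasurableSet D := by
    obtain ⟨u, hu, hus⟩ := continuousOn_iff'.1 (continuousOn_extChartAt_symm (I := I) z₀.proj)
      _ (isOpen_extChartAt_source (I := I) z₁.proj)
    rw [hDdef, inter_comm, hus]
    exact hu.measurableSet.inter (measurableSet_extChartAt_target I M z₀.proj)
  have hτ : ∀ q ∈ D, HasFDerivWithinAt (e₁ ∘ e₀.symm) (τ' q) D q := by
    intro q hq
    have h0 := (mdifferentiableWithinAt_extChartAt_symm (I := I) hq.1).hasMFDerivWithinAt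
    have h1 := (mdifferentiableAt_extChartAt (I := I) (x := z₁.proj) (y := e₀.symm q)
      (by simpa [he₁] using hq.2)).hasMFDerivAt
    exact (hasMFDerivWithinAt_iff_hasFDerivWithinAt.1 (h1.comp_hasMFDerivWithinAt q h0)).mono
      (inter_subset_left.trans (extChartAt_target_subset_range z₀.proj))
  have hinj : InjOn (e₁ ∘ e₀.symm) D := fun q hq q' hq' h =>
    e₀.symm.injOn hq.1 hq'.1 (e₁.injOn hq.2 hq'.2 h)
  have hdet : ∀ q ∈ D, LinearMap.det (τ' q : _ →ₗ[ℝ] EuclideanSpace ℝ (Fin n)) ≠ 0 := by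
    intro q hq
    obtain ⟨A, hA⟩ := isInvertible_mfderivWithin_extChartAt_symm (I := I) hq.1
    obtain ⟨B, hB⟩ := isInvertible_mfderiv_extChartAt (I := I) hq.2
    let C : EuclideanSpace ℝ (Fin n) ≃L[ℝ] EuclideanSpace ℝ (Fin n) := A.trans B
    have : τ' q = C := by
      refine ContinuousLinearMap.ext fun v => ?_
      have hA' := congrArg
        (fun L : EuclideanSpace ℝ (Fin n) →L[ℝ] EuclideanSpace ℝ (Fin n) => L v) hA
      have hB' := congrArg
        (fun L : EuclideanSpace ℝ (Fin n) →L[ℝ] EuclideanSpace ℝ (Fin n) => L (A v)) hB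
      exact (hB'.trans (congrArg (mfderiv I 𝓘(ℝ, EuclideanSpace ℝ (Fin n)) e₁ (e₀.symm q))
        hA')).symm
    rw [this]
    exact (LinearEquiv.isUnit_det' C.toLinearEquiv).ne_zero
  rw [cotangentModelBasis_addHaar_eq_prod]
  have hmem : ∀ y ∈ (extChartAt (CotangentBundle.model I) z₀).target ∩
      (extChartAt (CotangentBundle.model I) z₀).symm ⁻¹' S, y.1 ∈ D := by
    rintro y ⟨hy, hyS⟩
    rw [cotangent_extChartAt_target] at hy
    refine ⟨hy.1, ?_⟩
    have := hS₁ hyS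
    rwa [cotangent_extChartAt_source, mem_preimage,
      cotangent_extChartAt_symm_proj I M z₀ hy.1] at this
  refine prod_measure_le_of_cotangent_lift _ _ hD hτ hinj hdet
    ((continuousOn_extChartAt_symm z₀).measurableSet_inter_preimage
      (measurableSet_cotangent_target I M z₀) hS)
    ((continuousOn_extChartAt_symm z₁).measurableSet_inter_preimage
      (measurableSet_cotangent_target I M z₁) hS) hmem ?_
  rintro q hq P ⟨_, hP⟩
  have hqt : (e₁ ∘ e₀.symm) q ∈ e₁.target := e₁.map_source hq.2
  refine ⟨by rw [cotangent_extChartAt_target]; exact ⟨hqt, mem_univ _⟩, ?_⟩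
  set z := (extChartAt (CotangentBundle.model I) z₁).symm ((e₁ ∘ e₀.symm) q, P) with hz
  have hzp : z.proj = e₀.symm q := by
    rw [hz, cotangent_extChartAt_symm_proj I M z₁ hqt]
    exact e₁.left_inv hq.2
  have hz0 : z.proj ∈ e₀.source := by rw [hzp]; exact e₀.map_target hq.1
  have hzq : e₀ z.proj = q := by rw [hzp]; exact e₀.right_inv hq.1
  have key : extChartAt (CotangentBundle.model I) z₀ z = (q, P.comp (τ' q)) := by
    rw [cotangent_extChartAt_apply I M z₀ hz0]
    refine Prod.ext hzq ?_
    have h1 := cotangent_extChartAt_symm_snd I M z₁ (y := ((e₁ ∘ e₀.symm) q, P)) hqt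
    have h2 := mfderivWithin_extChartAt_symm_comp_mfderiv_extChartAt' (I := I) hq.2
    refine ContinuousLinearMap.ext fun v => ?_
    have h3 := fun u => congrArg (fun L : EuclideanSpace ℝ (Fin n) →L[ℝ] ℝ => L u) h1
    refine Eq.trans ?_ (h3 (τ' q v))
    have h4 := congrArg (fun L : EuclideanSpace ℝ (Fin n) →L[ℝ] EuclideanSpace ℝ (Fin n) =>
      L (mfderivWithin 𝓘(ℝ, EuclideanSpace ℝ (Fin n)) I e₀.symm (range I) q v)) h2
    rw [hzq]
    exact congrArg (fun u : EuclideanSpace ℝ (Fin n) => z.snd u) h4.symm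
  have hz1 : z = (extChartAt (CotangentBundle.model I) z₀).symm (q, P.comp (τ' q)) := by
    rw [← key]
    exact ((extChartAt (CotangentBundle.model I) z₀).left_inv
      (by rw [cotangent_extChartAt_source]; exact hz0)).symm
  rw [mem_preimage, ← hz, hz1]
  exact hP
end

/-! ### The Liouville measure -/

section
variable {n : ℕ} {H : Type*} [TopologicalSpace H]
  (I : ModelWithCorners ℝ (EuclideanSpace ℝ (Fin n)) H)
  (M : Type*) [TopologicalSpace M] [ChartedSpace H M] [IsManifold I ∞ M]

theorem measurableSet_cotangent_source (z₀ : CotangentBundle I M) :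
    MeasurableSet (extChartAt (CotangentBundle.model I) z₀).source :=
  (isOpen_extChartAt_source (I := CotangentBundle.model I) z₀).measurableSet

/-- No other chart contributes more than the chart at `z₀` inside the domain of that chart, so the
supremum over all charts, an uncountable family, stays locally finite. -/
theorem liouvilleMeasure_le_liouvilleChartMeasure (z₀ : CotangentBundle I M)
    {S : Set (CotangentBundle I M)}
    (hS : S ⊆ (extChartAt (CotangentBundle.model I) z₀).source) :
    liouvilleMeasure I M S ≤ liouvilleChartMeasure I M z₀ S := by
  have hs := measurableSet_cotangent_source I M z₀
  -- the right-hand side dominates the measure of every chart, hence their supremum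
  have key : liouvilleMeasure I M ≤ liouvilleChartMeasure I M z₀ +
      (liouvilleMeasure I M).restrict (extChartAt (CotangentBundle.model I) z₀).sourceᶜ := by
    conv_lhs => rw [liouvilleMeasure_eq_iSup]
    refine iSup_le fun z₁ => Measure.le_iff.2 fun T hT => ?_
    rw [Measure.add_apply, Measure.restrict_apply hT, ← measure_inter_add_sdiff T hs]
    refine add_le_add ((liouvilleChartMeasure_le I M z₁ z₀ (hT.inter hs) inter_subset_right).trans
      (measure_mono inter_subset_left)) ?_
    rw [sdiff_eq]
    exact (le_iSup (liouvilleChartMeasure I M) z₁) _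
  refine (key S).trans ?_
  rw [Measure.add_apply, Measure.restrict_apply' hs.compl,
    (disjoint_compl_right_iff_subset.2 hS).inter_eq,
    measure_empty, add_zero]

instance isLocallyFiniteMeasure_liouvilleMeasure :
    IsLocallyFiniteMeasure (liouvilleMeasure I M) := by
  refine ⟨fun z₀ => ?_⟩
  set φ := extChartAt (CotangentBundle.model I) z₀ with hφ
  obtain ⟨u, hu, hu'⟩ := continuousOn_iff'.1
    (continuousOn_extChartAt (I := CotangentBundle.model I) z₀) _
    (Metric.isOpen_ball (x := φ z₀) (ε := 1))
  have hsrc := isOpen_extChartAt_source (I := CotangentBundle.model I) z₀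
  have hO : IsOpen (φ ⁻¹' Metric.ball (φ z₀) 1 ∩ φ.source) := by rw [hu']; exact hu.inter hsrc
  refine ⟨_, hO.mem_nhds ⟨Metric.mem_ball_self one_pos, mem_extChartAt_source z₀⟩, ?_⟩
  refine (liouvilleMeasure_le_liouvilleChartMeasure I M z₀ inter_subset_right).trans_lt ?_
  rw [liouvilleChartMeasure_apply I M z₀ hO.measurableSet]
  refine ENNReal.mul_lt_top ENNReal.ofReal_lt_top
    ((measure_mono ?_).trans_lt (measure_ball_lt_top (x := φ z₀) (r := 1)))
  rintro y ⟨hy, hy'⟩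
  have := hy'.1
  rwa [mem_preimage, φ.right_inv hy] at this

instance isOpenPosMeasure_liouvilleMeasure :
    (liouvilleMeasure I M).IsOpenPosMeasure := by
  refine ⟨fun O hO ⟨z₀, hz₀⟩ h0 => ?_⟩
  set φ := extChartAt (CotangentBundle.model I) z₀ with hφ
  have h1 : liouvilleChartMeasure I M z₀ O = 0 :=
    le_antisymm ((le_iSup (liouvilleChartMeasure I M) z₀ O).trans h0.le) bot_le
  rw [liouvilleChartMeasure_apply I M z₀ hO.measurableSet, mul_eq_zero, or_iff_right (by
    simpa using liouvilleDensity_pos n)] at h1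
  have hnh : φ.target ∩ φ.symm ⁻¹' O ∈ 𝓝[range (CotangentBundle.model I)] (φ z₀) := by
    refine Filter.inter_mem (extChartAt_target_mem_nhdsWithin z₀) ?_
    exact nhdsWithin_le_nhds ((continuousAt_extChartAt_symm z₀).preimage_mem_nhds
      (by rw [extChartAt_to_inv]; exact hO.mem_nhds hz₀))
  obtain ⟨u, hu, hzu, hsub⟩ := mem_nhdsWithin.1 hnh
  have hcl := (CotangentBundle.model I).range_subset_closure_interior
    (extChartAt_target_subset_range z₀ (mem_extChartAt_target z₀))
  -- at a boundary point the chart target still meets the interior of the range of the model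
  obtain ⟨y, hyu, hyi⟩ := mem_closure_iff.1 hcl u hu hzu
  have hpos : 0 < (cotangentModelBasis n).addHaar
      (u ∩ interior (range (CotangentBundle.model I))) :=
    (hu.inter isOpen_interior).measure_pos _ ⟨y, hyu, hyi⟩
  refine hpos.ne' (measure_mono_null ?_ h1)
  exact (inter_subset_inter_right _ interior_subset).trans hsub

theorem CotangentBundle.continuous_scale (t : ℝ) :
    Continuous (CotangentBundle.scale t : CotangentBundle I M → CotangentBundle I M) := by
  refine continuous_iff_continuousAt.2 fun z₀ => ?_
  rw [continuousAt_hom_bundle]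
  have h := (continuousAt_hom_bundle (RingHom.id ℝ) (fun z : CotangentBundle I M => z) (x₀ := z₀)).1
    continuousAt_id
  refine ⟨h.1, (h.2.const_smul t).congr (Filter.Eventually.of_forall fun z => ?_)⟩
  ext v
  simp [ContinuousLinearMap.inCoordinates, CotangentBundle.scale]

theorem cotangent_extChartAt_symm_scale (z₀ : CotangentBundle I M) (t : ℝ) {y : CotangentModel n}
    (hy : y.1 ∈ (extChartAt I z₀.proj).target) :
    CotangentBundle.scale t ((extChartAt (CotangentBundle.model I) z₀).symm y)
      = (extChartAt (CotangentBundle.model I) z₀).symm (y.1, t • y.2) := by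
  set z := (extChartAt (CotangentBundle.model I) z₀).symm y with hz
  have hp : z.proj = (extChartAt I z₀.proj).symm y.1 := cotangent_extChartAt_symm_proj I M z₀ hy
  have hs : z.proj ∈ (extChartAt I z₀.proj).source := by
    rw [hp]; exact (extChartAt I z₀.proj).map_target hy
  have hq : extChartAt I z₀.proj z.proj = y.1 := by
    rw [hp]; exact (extChartAt I z₀.proj).right_inv hy
  have key : extChartAt (CotangentBundle.model I) z₀ (CotangentBundle.scale t z)
      = (y.1, t • y.2) := by
    rw [cotangent_extChartAt_apply I M z₀ (z := CotangentBundle.scale t z) hs]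
    refine Prod.ext hq ?_
    have h1 := cotangent_extChartAt_symm_snd I M z₀ hy
    change ContinuousLinearMap.comp (t • z.snd) (mfderivWithin 𝓘(ℝ, EuclideanSpace ℝ (Fin n)) I
        (extChartAt I z₀.proj).symm (range I) (extChartAt I z₀.proj z.proj)) = t • y.2
    rw [hq]
    exact (ContinuousLinearMap.smul_comp t _ _).trans
      (congrArg (fun L : EuclideanSpace ℝ (Fin n) →L[ℝ] ℝ => t • L) h1)
  rw [← key]
  exact ((extChartAt (CotangentBundle.model I) z₀).left_inv
    (by rw [cotangent_extChartAt_source]; exact hs)).symm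

theorem liouvilleChartMeasure_scale (z₀ : CotangentBundle I M) {t : ℝ} (ht : 0 < t)
    {S : Set (CotangentBundle I M)} (hS : MeasurableSet S) :
    ENNReal.ofReal t ^ n * liouvilleChartMeasure I M z₀ (CotangentBundle.scale t ⁻¹' S)
      = liouvilleChartMeasure I M z₀ S := by
  rw [liouvilleChartMeasure_apply I M z₀ hS,
    liouvilleChartMeasure_apply I M z₀ ((CotangentBundle.continuous_scale I M t).measurable hS),
    mul_left_comm,
    ← cotangentModelBasis_addHaar_preimage_fibre_smul ht
      ((continuousOn_extChartAt_symm z₀).measurableSet_inter_preimage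
        (measurableSet_cotangent_target I M z₀) hS)]
  congr 3
  ext y
  simp only [cotangent_extChartAt_target, mem_inter_iff, mem_prod, mem_univ, and_true, mem_preimage]
  refine and_congr_right fun hy => ?_
  rw [cotangent_extChartAt_symm_scale I M z₀ t hy]

theorem liouvilleMeasure_le_scale {t : ℝ} (ht : 0 < t)
    {S : Set (CotangentBundle I M)} (hS : MeasurableSet S) :
    liouvilleMeasure I M S
      ≤ ENNReal.ofReal t ^ n * liouvilleMeasure I M (CotangentBundle.scale t ⁻¹' S) := by
  have hm := (CotangentBundle.continuous_scale I M t).measurable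
  have key : liouvilleMeasure I M
      ≤ ENNReal.ofReal t ^ n • (liouvilleMeasure I M).map (CotangentBundle.scale t) := by
    conv_lhs => rw [liouvilleMeasure_eq_iSup]
    refine iSup_le fun z₁ => Measure.le_iff.2 fun T hT => ?_
    rw [Measure.smul_apply, Measure.map_apply hm hT, smul_eq_mul,
      ← liouvilleChartMeasure_scale I M z₁ ht hT]
    gcongr
    exact le_iSup (liouvilleChartMeasure I M) z₁
  simpa [Measure.map_apply hm hS] using key S

/-- The opposite inequality is `liouvilleMeasure_le_scale` for `t⁻¹`. -/
theorem liouvilleMeasure_scale {t : ℝ} (ht : 0 < t)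
    {S : Set (CotangentBundle I M)} (hS : MeasurableSet S) :
    ENNReal.ofReal t ^ n * liouvilleMeasure I M (CotangentBundle.scale t ⁻¹' S)
      = liouvilleMeasure I M S := by
  refine le_antisymm ?_ (liouvilleMeasure_le_scale I M ht hS)
  have h := liouvilleMeasure_le_scale I M (inv_pos.2 ht)
    ((CotangentBundle.continuous_scale I M t).measurable hS)
  have e : CotangentBundle.scale t⁻¹ ⁻¹' (CotangentBundle.scale t ⁻¹' S) = S := by
    ext z
    have : CotangentBundle.scale t (CotangentBundle.scale t⁻¹ z) = z := by
      obtain ⟨x, p⟩ := z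
      exact congrArg (TotalSpace.mk x) (smul_inv_smul₀ ht.ne' p)
    rw [mem_preimage, mem_preimage, this]
  rw [e] at h
  calc _ ≤ ENNReal.ofReal t ^ n * (ENNReal.ofReal t⁻¹ ^ n * liouvilleMeasure I M S) := by gcongr
    _ = _ := by
      rw [← mul_assoc, ← mul_pow, ← ENNReal.ofReal_mul ht.le, mul_inv_cancel₀ ht.ne',
        ENNReal.ofReal_one, one_pow, one_mul]
end

/-! ### Volumes of star bodies -/

section
variable {n : ℕ} {H : Type*} [TopologicalSpace H]
  {I : ModelWithCorners ℝ (EuclideanSpace ℝ (Fin n)) H}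
  {M : Type*} [TopologicalSpace M] [ChartedSpace H M] [IsManifold I ∞ M]

theorem StarBody.volume_lt_top (A : StarBody I M) : A.volume < ⊤ := by
  have hc : IsCompact A.carrier := by
    have := A.hamiltonian.proper.isCompact_preimage (isCompact_Icc (a := (0 : ℝ)) (b := 1))
    rw [A.carrier_eq]
    convert this using 1
    ext z
    simp [A.hamiltonian.nonneg z]
  exact hc.measure_lt_top

theorem StarBody.volume_pos [Nonempty M] (A : StarBody I M) : 0 < A.volume := by
  obtain ⟨x⟩ := ‹Nonempty M›
  have ho : IsOpen {z | A.hamiltonian.toFun z < 1} :=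
    isOpen_lt A.hamiltonian.continuous_toFun continuous_const
  have hx : A.hamiltonian.toFun (⟨x, 0⟩ : CotangentBundle I M) < 1 := by
    rw [A.hamiltonian.toFun_zero rfl]; exact one_pos
  refine (ho.measure_pos (liouvilleMeasure I M) ⟨_, hx⟩).trans_le (measure_mono ?_)
  rw [A.carrier_eq]
  exact fun z (hz : A.hamiltonian.toFun z < 1) => (show A.hamiltonian.toFun z ≤ 1 from hz.le)

theorem StarBody.sigmaCompactSpace (A : StarBody I M) :
    SigmaCompactSpace (CotangentBundle I M) := by
  refine ⟨⟨fun k => A.hamiltonian.toFun ⁻¹' Icc 0 k, fun k =>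
    A.hamiltonian.proper.isCompact_preimage isCompact_Icc, eq_univ_of_forall fun z => ?_⟩⟩
  obtain ⟨k, hk⟩ := exists_nat_ge (A.hamiltonian.toFun z)
  exact mem_iUnion.2 ⟨k, A.hamiltonian.nonneg z, hk⟩

/-- The zero section is a null set: it is compact, hence of finite measure, and it is invariant
under dilations, which multiply the measure by `t ^ n`. -/
theorem StarHamiltonian.ae_pos (hn : 1 ≤ n) (h : StarHamiltonian I M) :
    ∀ᵐ z ∂liouvilleMeasure I M, 0 < h.toFun z := by
  have hm : MeasurableSet {z | h.toFun z = 0} :=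
    (isClosed_eq h.continuous_toFun continuous_const).measurableSet
  have hfin : liouvilleMeasure I M {z | h.toFun z = 0} ≠ ⊤ :=
    (h.proper.isCompact_preimage (isCompact_singleton (x := (0 : ℝ)))).measure_lt_top.ne
  have hs := liouvilleMeasure_scale I M two_pos hm
  have e : CotangentBundle.scale 2 ⁻¹' {z | h.toFun z = 0} = {z | h.toFun z = 0} := by
    ext z
    simp [h.homogeneous 2 two_pos]
  rw [e] at hs
  have h0 : liouvilleMeasure I M {z | h.toFun z = 0} = 0 := by
    by_contra hne
    have : ENNReal.ofReal 2 ^ n = 1 := by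
      rw [← ENNReal.mul_left_inj hne hfin, one_mul, hs]
    rw [← ENNReal.ofReal_pow (by norm_num), ENNReal.ofReal_eq_one] at this
    exact (one_lt_pow₀ (one_lt_two (α := ℝ)) (by omega)).ne' this
  filter_upwards [measure_eq_zero_iff_ae_notMem.1 h0] with z hz
  exact (h.nonneg z).lt_of_ne' hz

theorem StarBody.volume_eq_lintegral (hn : 1 ≤ n) (A B : StarBody I M) :
    B.volume = ∫⁻ z in A.carrier,
      ENNReal.ofReal (A.hamiltonian.toFun z / B.hamiltonian.toFun z) ^ n ∂liouvilleMeasure I M := by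
  have := A.sigmaCompactSpace
  have h := measure_sublevel_eq_lintegral_ratio_pow hn
    (fun t ht S hS => liouvilleMeasure_scale I M ht hS)
    A.hamiltonian.continuous_toFun.measurable B.hamiltonian.continuous_toFun.measurable
    A.hamiltonian.homogeneous B.hamiltonian.homogeneous
    (A.hamiltonian.ae_pos hn) (B.hamiltonian.ae_pos hn)
  rwa [← A.carrier_eq, ← B.carrier_eq] at h

theorem StarBody.volume_radialSum_eq_lintegral (hn : 1 ≤ n) (A B : StarBody I M) :
    (A.radialSum B).volume = ∫⁻ z in A.carrier,
      ENNReal.ofReal (1 + A.hamiltonian.toFun z / B.hamiltonian.toFun z) ^ n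
        ∂liouvilleMeasure I M := by
  have e : (A.radialSum B).hamiltonian.toFun = (A.hamiltonian.radialSum B.hamiltonian).toFun :=
    StarHamiltonian.toFun_unique (A.radialSum B).carrier_eq.symm
  rw [A.volume_eq_lintegral hn, e]
  refine lintegral_congr_ae (ae_restrict_of_ae ?_)
  filter_upwards [A.hamiltonian.ae_pos hn, B.hamiltonian.ae_pos hn] with z ha hb
  congr 2
  simp only [StarHamiltonian.radialSum]
  field_simp

theorem StarBody.carrier_eq_dilate_iff (A B : StarBody I M) {c : ℝ} (hc : 0 < c) :
    B.carrier = (A.dilate c hc).carrier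
      ↔ ∀ z, B.hamiltonian.toFun z = c⁻¹ * A.hamiltonian.toFun z := by
  constructor
  · intro h z
    have e : B.hamiltonian.toFun = (A.hamiltonian.dilate c hc).toFun :=
      StarHamiltonian.toFun_unique (B.carrier_eq.symm.trans h)
    exact congrFun e z
  · intro h
    rw [B.carrier_eq]
    ext z
    simp [StarBody.dilate, StarHamiltonian.dilate, h z]

/-- A ratio that is constant almost everywhere on the body is constant: the exceptional set in the
interior, off the zero section, is open and null, and every nonzero covector has a multiple in the
interior. -/
theorem StarHamiltonian.eq_const_mul_of_ae_ratio_eq {h k : StarHamiltonian I M} {c : ℝ}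
    (hae : ∀ᵐ z ∂(liouvilleMeasure I M).restrict {z | h.toFun z ≤ 1},
      h.toFun z / k.toFun z = c) (hc : 0 < c) (z : CotangentBundle I M) :
    k.toFun z = c⁻¹ * h.toFun z := by
  by_cases hz : z.snd = 0
  · rw [h.toFun_zero hz, k.toFun_zero hz, mul_zero]
  have ho : IsOpen {z | h.toFun z < 1 ∧ 0 < h.toFun z ∧ k.toFun z ≠ c⁻¹ * h.toFun z} :=
    (isOpen_lt h.continuous_toFun continuous_const).and
      ((isOpen_lt continuous_const h.continuous_toFun).and
        (isOpen_ne_fun k.continuous_toFun (continuous_const.mul h.continuous_toFun)))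
  have h0 : liouvilleMeasure I M
      {z | h.toFun z < 1 ∧ 0 < h.toFun z ∧ k.toFun z ≠ c⁻¹ * h.toFun z} = 0 := by
    rw [ae_restrict_iff' (isClosed_le h.continuous_toFun continuous_const).measurableSet] at hae
    refine measure_mono_null (fun w hw => ?_) (ae_iff.1 hae)
    intro hcon
    have hr := hcon (show h.toFun w ≤ 1 from hw.1.le)
    have hk : k.toFun w ≠ 0 := fun hk => by rw [hk, div_zero] at hr; exact hc.ne hr
    refine hw.2.2 ?_
    rw [← hr]
    have := hw.2.1
    field_simp
  have hemp := (ho.measure_eq_zero_iff (liouvilleMeasure I M)).1 h0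
  have hp := h.pos z hz
  have ht : 0 < 1 / (2 * h.toFun z) := by positivity
  by_contra hne
  have : CotangentBundle.scale (1 / (2 * h.toFun z)) z ∈
      {z | h.toFun z < 1 ∧ 0 < h.toFun z ∧ k.toFun z ≠ c⁻¹ * h.toFun z} := by
    simp only [mem_ofPred_eq, h.homogeneous _ ht, k.homogeneous _ ht]
    refine ⟨?_, by positivity, fun he => hne ?_⟩
    · field_simp; norm_num
    · rw [mul_left_comm] at he
      exact mul_left_cancel₀ ht.ne' he
  rw [hemp] at this
  exact this

theorem StarBody.exists_volume_eq_ofReal_pow [Nonempty M] (hn : 1 ≤ n) (A : StarBody I M) :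
    ∃ a : ℝ, 0 < a ∧ A.volume = ENNReal.ofReal a ^ n := by
  have hpos : 0 < A.volume ^ ((n : ℝ)⁻¹) := ENNReal.rpow_pos A.volume_pos A.volume_lt_top.ne
  have htop : A.volume ^ ((n : ℝ)⁻¹) ≠ ⊤ :=
    ENNReal.rpow_ne_top_of_nonneg (by positivity) A.volume_lt_top.ne
  refine ⟨(A.volume ^ ((n : ℝ)⁻¹)).toReal, ENNReal.toReal_pos hpos.ne' htop, ?_⟩
  rw [ENNReal.ofReal_toReal htop, ENNReal.rpow_inv_natCast_pow (by omega)]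
end

theorem mainTheorem8 {n : ℕ} (hn : 1 ≤ n) {H : Type*} [TopologicalSpace H]
    (I : ModelWithCorners ℝ (EuclideanSpace ℝ (Fin n)) H)
    (M : Type*) [TopologicalSpace M] [T2Space M] [CompactSpace M] [ChartedSpace H M]
    [IsManifold I ∞ M] (A B : StarBody I M) :
    (A.volume < ⊤ ∧ B.volume < ⊤ ∧ (A.radialSum B).volume < ⊤) ∧
    (A.radialSum B).volume ^ (1 / n : ℝ) ≤ A.volume ^ (1 / n : ℝ) + B.volume ^ (1 / n : ℝ) ∧
    (2 ≤ n →
      ((A.radialSum B).volume ^ (1 / n : ℝ) = A.volume ^ (1 / n : ℝ) + B.volume ^ (1 / n : ℝ) ↔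
        ∃ (c : ℝ) (hc : 0 < c), B.carrier = (A.dilate c hc).carrier)) := by
  refine ⟨⟨A.volume_lt_top, B.volume_lt_top, (A.radialSum B).volume_lt_top⟩, ?_⟩
  have hn0 : n ≠ 0 := by omega
  rcases isEmpty_or_nonempty M with hM | hM
  · have hZ : IsEmpty (CotangentBundle I M) := ⟨fun z => hM.false z.proj⟩
    have h0 : ∀ S : StarBody I M, S.volume = 0 := fun S => by
      rw [StarBody.volume, Measure.eq_zero_of_isEmpty (liouvilleMeasure I M)]
      rfl
    have hz : (0 : ℝ≥0∞) ^ (1 / n : ℝ) = 0 := ENNReal.zero_rpow_of_pos (by positivity)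
    simp only [h0, hz, add_zero, le_refl, true_and, true_iff]
    exact fun _ => ⟨1, one_pos, Set.ext fun z => isEmptyElim z⟩
  obtain ⟨a, ha, hVA⟩ := A.exists_volume_eq_ofReal_pow hn
  obtain ⟨b, hb, hVB⟩ := B.exists_volume_eq_ofReal_pow hn
  have hroot : ∀ {S : StarBody I M} {s : ℝ}, S.volume = ENNReal.ofReal s ^ n →
      S.volume ^ (1 / n : ℝ) = ENNReal.ofReal s := fun h => by
    rw [h, one_div, ENNReal.pow_rpow_inv_natCast hn0]
  rw [hroot hVA, hroot hVB, ← ENNReal.ofReal_add ha.le hb.le]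
  set r : CotangentBundle I M → ℝ := fun z => A.hamiltonian.toFun z / B.hamiltonian.toFun z with hr
  have hrm : Measurable r :=
    A.hamiltonian.continuous_toFun.measurable.div B.hamiltonian.continuous_toFun.measurable
  have hr0 : ∀ z, 0 ≤ r z := fun z => div_nonneg (A.hamiltonian.nonneg z) (B.hamiltonian.nonneg z)
  have hA : (liouvilleMeasure I M).restrict A.carrier univ = ENNReal.ofReal a ^ n := by
    rw [Measure.restrict_apply_univ]; exact hVA
  have hB : ∫⁻ z in A.carrier, ENNReal.ofReal (r z) ^ n ∂liouvilleMeasure I M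
      = ENNReal.ofReal b ^ n := by rw [← hVB, A.volume_eq_lintegral hn B]
  have hC := A.volume_radialSum_eq_lintegral hn B
  refine ⟨?_, fun hn2 => ⟨fun he => ?_, ?_⟩⟩
  · have h := lintegral_one_add_pow_le hn hrm ha hb hr0 hA hB
    rw [← hC] at h
    refine (ENNReal.rpow_le_rpow h (by positivity : (0 : ℝ) ≤ 1 / n)).trans_eq ?_
    rw [one_div, ENNReal.pow_rpow_inv_natCast hn0]
  · have he' : (A.radialSum B).volume = ENNReal.ofReal (a + b) ^ n := by
      rw [← he, one_div, ENNReal.rpow_inv_natCast_pow hn0]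
    have hae := ae_eq_of_lintegral_one_add_pow_eq hn2 hrm ha hb hr0 hA hB (hC ▸ he')
    rw [A.carrier_eq] at hae
    have hc : 0 < b / a := div_pos hb ha
    exact ⟨b / a, hc, (A.carrier_eq_dilate_iff B hc).2
      (StarHamiltonian.eq_const_mul_of_ae_ratio_eq hae hc)⟩
  · rintro ⟨c, hc, hBA⟩
    rw [A.carrier_eq_dilate_iff B hc] at hBA
    have hrc : ∀ᵐ z ∂(liouvilleMeasure I M).restrict A.carrier, r z = c := by
      refine ae_restrict_of_ae ?_
      filter_upwards [A.hamiltonian.ae_pos hn] with z hz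
      simp only [hr, hBA z]
      field_simp
    have hbc : b = c * a := by
      rw [lintegral_congr_ae (g := fun _ => ENNReal.ofReal c ^ n)
        (hrc.mono fun z hz => by simp only [hz]), lintegral_const, hA, ← mul_pow,
        ← ENNReal.ofReal_mul hc.le, ← ENNReal.ofReal_pow (by positivity),
        ← ENNReal.ofReal_pow hb.le, ENNReal.ofReal_eq_ofReal_iff (by positivity) (by positivity),
        pow_left_inj₀ (by positivity) hb.le hn0] at hB
      exact hB.symm
    refine hroot ?_
    rw [hC, lintegral_congr_ae (g := fun _ => ENNReal.ofReal (1 + c) ^ n)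
        (hrc.mono fun z hz => by simp only [hr] at hz; simp only [hz]), lintegral_const, hA,
        ← mul_pow, ← ENNReal.ofReal_mul (by positivity), hbc]
    congr 2
    ring
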